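/- **Theorem 3.3.** Let $n\ge 2$, let $0\le\lambda_1,\dots,\lambda_n<\infty$ with $\lambda_i\ne\frac12$ for at least one $i$, and put $q(z,\bar z)=\sum_{i=1}^n\big(|z_i|^2+\lambda_i(z_i^2+\bar z_i^2)\big)$. Let $p,E\in\mathbb C[[z,\bar z]]$, $z=(z_1,\dots,z_n)$, be real-valued formal power series (invariant under the formal conjugation which exchanges $z_i$ and $\bar z_i$ and conjugates the coefficients) of order at least $3$, and let $M$ be the formal $2n$-dimensional submanifold of $\mathbb C^{n+1}$ defined by $w=q+p+iE$. Write $G=q+p$, let subscripts $j$ and $\bar j$ denote $\partial/\partial z_j$ and $\partial/\partial\bar z_j$, let a bar over a series denote its formal conjugate, and for $1\le j\le n-1$ set $$A=G_n-iE_n,\qquad B_{(j)}=G_j-iE_j,\qquad C_{(j)}=2i(G_nE_j-G_jE_n),$$ $$L_j=A\frac{\partial}{\partial z_j}-B_{(j)}\frac{\partial}{\partial z_n}+C_{(j)}\frac{\partial}{\partial w}.$$ Let $\lambda_{(1jk)},\lambda_{(2jk)},\lambda_{(3jk)},\lambda_{(4jk)},\lambda_{(6jk)}$ be the coefficients of $\partial_{\bar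 z_k},\partial_{\bar z_n},\partial_{\bar w},\partial_{z_j},\partial_w$ in $[L_j,\overline{L_k}]$, that is, $$\lambda_{(1jk)}=A\bar A_j-B_{(j)}\bar A_n,\quad \lambda_{(2jk)}=-A(\overline{B_{(k)}})_j+B_{(j)}(\overline{B_{(k)}})_n,\quad \lambda_{(3jk)}=A(\overline{C_{(k)}})_j-B_{(j)}(\overline{C_{(k)}})_n,$$ $$\lambda_{(4jk)}=-\bar A A_{\bar k}+\overline{B_{(k)}}A_{\bar n},\qquad \lambda_{(6jk)}=-\bar A(C_{(j)})_{\bar k}+\overline{B_{(k)}}(C_{(j)})_{\bar n},$$ where $\bar A_j=(\bar A)_j$, $\bar A_n=(\bar A)_n$, and let $\Gamma_{(s)}=A(\lambda_{(s11)})_1-B_{(1)}(\lambda_{(s11)})_n$ for $s=1,2,3$, which are the coefficients of $\partial_{\bar z_1},\partial_{\bar z_n},\partial_{\bar w}$ in $[L_1,[L_1,\overline{L_1}]]$. Assume that $M$ is *formally non-minimal*, which means that the following identities of formal power series hold: $$(\bar A\lambda_{(2jk)}+\overline{B_{(k)}}\lambda_{(1jk)})(A\lambda_{(611)}-C_{(1)}\lambda_{(411)})=(\bar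 A\lambda_{(211)}+\overline{B_{(1)}}\lambda_{(111)})(A\lambda_{(6jk)}-C_{(j)}\lambda_{(4jk)})$$ for all $1<j,k<n$; the same identity for $j=1$ and all $1<k<n$; and $$(\bar A\Gamma_{(2)}+\Gamma_{(1)}\overline{B_{(1)}})(\bar A\lambda_{(311)}-\lambda_{(111)}\overline{C_{(1)}})=(\bar A\Gamma_{(3)}-\Gamma_{(1)}\overline{C_{(1)}})(\bar A\lambda_{(211)}+\lambda_{(111)}\overline{B_{(1)}}).$$ Then for every positive integer $N$ there is a holomorphic transform near the origin of the special form $(z,w)\mapsto(z'=z,\ w'=w+f(z,w))$, where $f$ is a convergent power series with $f(z,w)=o(|z|^2+|w|)$ (that is, $f$ contains only monomials $z^\alpha w^k$ with $|\alpha|+2k\ge3$), such that in the new coordinates $M$ is defined by $w'=\rho(z',\bar z')$, i.e. $\rho(z,\bar z)=(w+f(z,w))|_{w=q+p+iE}$, with $\operatorname{Im}\rho=(\rho-\bar\rho)/(2i)$ vanishing to order at least $N$ at the origin. -/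

import Mathlib

noncomputable section

namespace FormalCR

open MvPowerSeries

/-- Formal power series with complex coefficients in the `2 * n` independent indeterminates
`z i` (indexed by `Sum.inl i`) and `conj (z i)` (indexed by `Sum.inr i`). -/
abbrev Series (n : ℕ) : Type := MvPowerSeries (Fin n ⊕ Fin n) ℂ

/-- Formal power series in the `n + 1` complex coordinates `z i` (indexed by `Sum.inl i`) and `w`
(indexed by `Sum.inr ()`) of the ambient space. -/
abbrev AmbientSeries (n : ℕ) : Type := MvPowerSeries (Fin n ⊕ Unit) ℂ

variable {n : ℕ}

/-- The indeterminate `z i`. -/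
def z (i : Fin n) : Series n := X (Sum.inl i)

/-- The indeterminate `conj (z i)`. -/
def zbar (i : Fin n) : Series n := X (Sum.inr i)

/-- The formal derivative with respect to `z i`. -/
def dz (i : Fin n) (φ : Series n) : Series n := pderiv ℂ (Sum.inl i) φ

/-- The formal derivative with respect to `conj (z i)`. -/
def dzbar (i : Fin n) (φ : Series n) : Series n := pderiv ℂ (Sum.inr i) φ

/-- Complex conjugation of formal power series: it conjugates every coefficient and exchanges
`z i` with `conj (z i)`. -/
def conj : Series n →+* Series n :=
  (MvPowerSeries.map (starRingEnd ℂ)).comp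
    (renameEquiv ℂ (Equiv.sumComm (Fin n) (Fin n)) : Series n →+* Series n)

/-- A formal power series in `z` and `conj z` is real-valued if it is its own conjugate. -/
def IsReal (φ : Series n) : Prop := conj φ = φ

/-- The imaginary part `(φ - conj φ) / (2 i)`. -/
def imPart (φ : Series n) : Series n := C (1 / (2 * Complex.I)) * (φ - conj φ)

/-- The quadric `q = ∑ i, (|z i| ^ 2 + l i * (z i ^ 2 + conj (z i) ^ 2))`. -/
def quadric (l : Fin n → ℝ) : Series n :=
  ∑ i, (z i * zbar i + C (l i : ℂ) * (z i ^ 2 + zbar i ^ 2))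

/-! ### The formal (1,0) vector fields

The formal submanifold `w = G + i E`, with `G` and `E` real-valued, is parametrized by `z`. In the
paragraphs below `b` is the index that plays the role of the last coordinate `n`, and the formal
vector field of type (1,0)

`L j = A ∂/∂z_j - B j ∂/∂z_b + C j ∂/∂w`

is tangent to it. All coefficients are formal power series in `z` and `conj z`. -/

/-- The coefficient `A = G_b - i E_b`. -/
def cA (b : Fin n) (G E : Series n) : Series n := dz b G - C Complex.I * dz b E

/-- The coefficient `B j = G_j - i E_j`. -/
def cB (G E : Series n) (j : Fin n) : Series n := dz j G - C Complex.I * dz j E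

/-- The coefficient `C j = 2 i (G_b E_j - G_j E_b)`. -/
def cC (b : Fin n) (G E : Series n) (j : Fin n) : Series n :=
  C (2 * Complex.I) * (dz b G * dz j E - dz j G * dz b E)

/-- The action of `L j` on power series in `z` and `conj z`. -/
def actL (b : Fin n) (G E : Series n) (j : Fin n) (φ : Series n) : Series n :=
  cA b G E * dz j φ - cB G E j * dz b φ

/-- The action of the conjugate of `L k` on power series in `z` and `conj z`. -/
def actLbar (b : Fin n) (G E : Series n) (k : Fin n) (φ : Series n) : Series n :=
  conj (cA b G E) * dzbar k φ - conj (cB G E k) * dzbar b φ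

/-! The bracket of `L j` with the conjugate of `L k` is
`lam1 ∂/∂conj(z_k) + lam2 ∂/∂conj(z_b) + lam3 ∂/∂conj(w) + lam4 ∂/∂z_j + lam5 ∂/∂z_b + lam6 ∂/∂w`.
The coefficient `lam5` is not needed. -/

/-- The coefficient of `∂/∂conj(z_k)` in the bracket of `L j` and the conjugate of `L k`. -/
def lam1 (b : Fin n) (G E : Series n) (j _k : Fin n) : Series n :=
  actL b G E j (conj (cA b G E))

/-- The coefficient of `∂/∂conj(z_b)` in the bracket of `L j` and the conjugate of `L k`. -/
def lam2 (b : Fin n) (G E : Series n) (j k : Fin n) : Series n :=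
  -actL b G E j (conj (cB G E k))

/-- The coefficient of `∂/∂conj(w)` in the bracket of `L j` and the conjugate of `L k`. -/
def lam3 (b : Fin n) (G E : Series n) (j k : Fin n) : Series n :=
  actL b G E j (conj (cC b G E k))

/-- The coefficient of `∂/∂z_j` in the bracket of `L j` and the conjugate of `L k`. -/
def lam4 (b : Fin n) (G E : Series n) (_j k : Fin n) : Series n :=
  -actLbar b G E k (cA b G E)

/-- The coefficient of `∂/∂w` in the bracket of `L j` and the conjugate of `L k`. -/
def lam6 (b : Fin n) (G E : Series n) (j k : Fin n) : Series n :=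
  -actLbar b G E k (cC b G E j)

/-! With `T` the bracket of `L a` and its conjugate, the components of the bracket of `L a` and `T`
along `∂/∂conj(z_a)`, `∂/∂conj(z_b)` and `∂/∂conj(w)` are `Gam1`, `Gam2` and `Gam3`. -/

/-- The coefficient of `∂/∂conj(z_a)` in the bracket of `L a` and `T`. -/
def Gam1 (a b : Fin n) (G E : Series n) : Series n := actL b G E a (lam1 b G E a a)

/-- The coefficient of `∂/∂conj(z_b)` in the bracket of `L a` and `T`. -/
def Gam2 (a b : Fin n) (G E : Series n) : Series n := actL b G E a (lam2 b G E a a)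

/-- The coefficient of `∂/∂conj(w)` in the bracket of `L a` and `T`. -/
def Gam3 (a b : Fin n) (G E : Series n) : Series n := actL b G E a (lam3 b G E a a)

/-- The identity expressing that the bracket of `L j` and the conjugate of `L k` is proportional
to `T` modulo the `L h` and their conjugates. -/
def BracketIdentity (a b : Fin n) (G E : Series n) (j k : Fin n) : Prop :=
  (conj (cA b G E) * lam2 b G E j k + conj (cB G E k) * lam1 b G E j k) *
      (cA b G E * lam6 b G E a a - cC b G E a * lam4 b G E a a) =
    (conj (cA b G E) * lam2 b G E a a + conj (cB G E a) * lam1 b G E a a) *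
      (cA b G E * lam6 b G E j k - cC b G E j * lam4 b G E j k)

/-- The identity expressing that the bracket of `L a` and `T` is proportional to `T` modulo the
`L h` and their conjugates. -/
def TripleBracketIdentity (a b : Fin n) (G E : Series n) : Prop :=
  (conj (cA b G E) * Gam2 a b G E + Gam1 a b G E * conj (cB G E a)) *
      (conj (cA b G E) * lam3 b G E a a - lam1 b G E a a * conj (cC b G E a)) =
    (conj (cA b G E) * Gam3 a b G E - Gam1 a b G E * conj (cC b G E a)) *
      (conj (cA b G E) * lam2 b G E a a + lam1 b G E a a * conj (cB G E a))

/-- The index of the first coordinate. -/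
def firstIdx (hn : 2 ≤ n) : Fin n := ⟨0, by omega⟩

/-- The index of the last coordinate. -/
def lastIdx (hn : 2 ≤ n) : Fin n := ⟨n - 1, by omega⟩

/-- Formal non-minimality of the formal submanifold `w = G + i E`, with `G` and `E` real-valued:
the bracket identity holds for all `1 < j, k < n`, and for `j = 1` and `1 < k < n`, and the triple
bracket identity holds. -/
structure FormallyNonMinimal (hn : 2 ≤ n) (G E : Series n) : Prop where
  bracket : ∀ j k : Fin n, j ≠ firstIdx hn → j ≠ lastIdx hn → k ≠ firstIdx hn → k ≠ lastIdx hn →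
    BracketIdentity (firstIdx hn) (lastIdx hn) G E j k
  bracket_first : ∀ k : Fin n, k ≠ firstIdx hn → k ≠ lastIdx hn →
    BracketIdentity (firstIdx hn) (lastIdx hn) G E (firstIdx hn) k
  triple : TripleBracketIdentity (firstIdx hn) (lastIdx hn) G E

/-! ### Holomorphic transforms -/

/-- A power series in finitely many indeterminates converges near the origin, that is, it is the
Taylor series of a germ of a holomorphic function, if it is absolutely convergent on some
polydisc. -/
def IsConvergent {σ : Type*} (f : MvPowerSeries σ ℂ) : Prop :=
  ∃ r : ℝ, 0 < r ∧ Summable fun d : σ →₀ ℕ => ‖coeff d f‖ * r ^ d.degree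

/-- The weights of the ambient coordinates: `z i` has weight 1 and `w` has weight 2. -/
def weight (n : ℕ) : Fin n ⊕ Unit → ℕ := Sum.elim (fun _ => 1) (fun _ => 2)

/-- `h` is the last component `w' = h (z, w)` of a holomorphic transform of the special form
`(z, w) ↦ (z' = z, w' = w + o(|z|^2 + |w|))`: it converges, and every monomial of `h - w` has
weight at least 3, i.e. is none of `1`, `z_i`, `z_i z_j`, `w`. -/
structure IsSpecialTransform (h : AmbientSeries n) : Prop where
  convergent : IsConvergent h
  special : 3 ≤ (h - X (Sum.inr ())).weightedOrder (weight n)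

/-- The transform `(z, w) ↦ (z, h (z, w))` takes the formal submanifold `w = ρ (z, conj z)` to the
formal submanifold with defining equation `w' = ρ' (z', conj z')`, where
`ρ' (z, conj z) = h (z, ρ (z, conj z))`. -/
def transformed (h : AmbientSeries n) (ρ : Series n) : Series n :=
  subst (Sum.elim z fun _ => ρ : Fin n ⊕ Unit → Series n) h

end FormalCR

end

/-!
The order of vanishing of the imaginary part is raised one step at a time, and each step is a
linear problem for homogeneous polynomials.

Here `f (z, q)` plus its conjugate is called the real part of `f (z, q)`, without the factor
`1 / 2`.

Write `ρ = G + i E` and `σ` for its conjugate. The components of the brackets of the vector fields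
`L j` and their conjugates transverse to these fields are the complex Hessians (`lev`) of `ρ` and
`σ` on the tangent directions of type (1,0) and (0,1). Non-minimality thus says that these two
Hessians are proportional and that a certain quotient is annihilated by `L a`
(`TransverseNonMinimal`, `FormallyNonMinimal.transverse`). In this form the condition is invariant
under `ρ ↦ h (z, ρ)` (`TransverseNonMinimal.plugSeries`), because `∂h/∂w` conjugated is
annihilated by all `L j`.

If `Im ρ` has leading form `P`, of degree `m`, the leading part of the identities is linear in `P`
(`TransverseNonMinimal.linearized`): on vectors tangent to the level sets of the quadric `q`, the
Hessian of `P` is `κ` times that of `q`, for some rational function `κ`, and one component of the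
antiholomorphic part of `dP - κ dq` is annihilated by a vector field of type (1,0) tangent to these
level sets. Two facts finish the linear problem (`exists_plug_of_linearized`).

* The function `κ` is a polynomial (`hessQuadric_dvd_hess`). With a third index available, this
  follows from an off-diagonal entry of the Hessian of `q`, a product of two linear forms. For
  `n = 2`, the polynomials `g` with `g κ` polynomial form an ideal stable under the tangential
  vector field and its conjugate. If the coefficients `l a`, `l b` are not both zero, this ideal
  contains a product of linear forms none of which divides the denominator; for `l a = l b` this
  needs `l a ≠ 1 / 2`. If both are zero, an Euler operator argument applies.
* A real-valued `P` with such a multiplier `κ` is the real part of some `f (z, q)`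
  (`IsMultiplier.exists_plug`). Indeed `κ` has a multiplier of its own
  (`IsMultiplier.exists_multiplier`) and smaller degree, so that by induction `κ` is the real part
  of some `g (z, q)`; subtracting the real part of `f (z, q)` with `∂f/∂w = g` leaves a polynomial
  with multiplier zero, and such polynomials are pluriharmonic.

Then `h ↦ h - 2 i f (z, h)` removes `P` from the imaginary part (`exists_special_succ`). All the
transforms are polynomials, hence converge.
-/

noncomputable section

namespace FormalCR

/-! ### Polynomials in `z` and `conj z` -/
section Polynomials

open MvPolynomial

variable {n : ℕ}

/-- Polynomials in the indeterminates `z i` (indexed by `Sum.inl i`) and `conj (z i)` (indexed by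
`Sum.inr i`). -/
abbrev Poly (n : ℕ) : Type := MvPolynomial (Fin n ⊕ Fin n) ℂ

/-- The derivative of polynomials with respect to `z i`. -/
abbrev pdz (i : Fin n) : Derivation ℂ (Poly n) (Poly n) := pderiv (Sum.inl i)

/-- The derivative of polynomials with respect to `conj (z i)`. -/
abbrev pdzbar (i : Fin n) : Derivation ℂ (Poly n) (Poly n) := pderiv (Sum.inr i)

/-- Complex conjugation of polynomials in `z` and `conj z`. -/
def pconj : Poly n →+* Poly n :=
  (MvPolynomial.map (starRingEnd ℂ)).comp (rename Sum.swap : Poly n →ₐ[ℂ] Poly n).toRingHom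

@[simp] lemma pconj_X_inl (i : Fin n) : pconj (X (Sum.inl i) : Poly n) = X (Sum.inr i) := by
  simp [pconj]

@[simp] lemma pconj_X_inr (i : Fin n) : pconj (X (Sum.inr i) : Poly n) = X (Sum.inl i) := by
  simp [pconj]

@[simp] lemma pconj_C (c : ℂ) : pconj (C c : Poly n) = C (starRingEnd ℂ c) := by
  simp [pconj]

@[simp] lemma pconj_pconj (f : Poly n) : pconj (pconj f) = f := by
  induction f using MvPolynomial.induction_on with
  | C a => simp
  | add p q hp hq => simp [hp, hq]
  | mul_X p i hp => rcases i with i | i <;> simp [hp]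

lemma pconj_pdz (i : Fin n) (f : Poly n) : pconj (pdz i f) = pdzbar i (pconj f) := by
  classical
  induction f using MvPolynomial.induction_on with
  | C a => simp
  | add p q hp hq => simp [hp, hq]
  | mul_X p j hp =>
    rcases j with j | j <;> simp [hp, pderiv_X, Pi.single_apply, apply_ite]

lemma pconj_pdzbar (i : Fin n) (f : Poly n) : pconj (pdzbar i f) = pdz i (pconj f) := by
  rw [← pconj_pconj (pdz i (pconj f)), pconj_pdz, pconj_pconj]

lemma pderiv_comm {σ : Type*} (i j : σ) (f : MvPolynomial σ ℂ) :
    pderiv i (pderiv j f) = pderiv j (pderiv i f) := by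
  ext m
  classical
  simp only [coeff_pderiv, Finsupp.add_apply, Finsupp.single_apply]
  rw [add_right_comm]
  by_cases h : i = j
  · subst h; ring
  · simp [h, Ne.symm h]; ring

/-- The derivative `conj (z i) + 2 l i z i` of the quadric with respect to `z i`. -/
def qz (l : Fin n → ℝ) (i : Fin n) : Poly n := X (Sum.inr i) + C (2 * (l i : ℂ)) * X (Sum.inl i)

/-- The derivative `z i + 2 l i conj (z i)` of the quadric with respect to `conj (z i)`. -/
def qzbar (l : Fin n → ℝ) (i : Fin n) : Poly n :=
  X (Sum.inl i) + C (2 * (l i : ℂ)) * X (Sum.inr i)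

@[simp] lemma pconj_qz (l : Fin n → ℝ) (i : Fin n) : pconj (qz l i) = qzbar l i := by
  simp [qz, qzbar, map_ofNat (starRingEnd ℂ) 2]

@[simp] lemma pconj_qzbar (l : Fin n → ℝ) (i : Fin n) : pconj (qzbar l i) = qz l i := by
  simp [qz, qzbar, map_ofNat (starRingEnd ℂ) 2]

lemma pdz_qz (l : Fin n → ℝ) (i j : Fin n) :
    pdz i (qz l j) = if i = j then C (2 * (l i : ℂ)) else 0 := by
  by_cases h : i = j
  · subst h; simp [qz, pderiv_X, -map_mul]
  · simp [qz, pderiv_X, h]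

lemma pdz_qzbar (l : Fin n → ℝ) (i j : Fin n) :
    pdz i (qzbar l j) = if i = j then 1 else 0 := by
  by_cases h : i = j
  · subst h; simp [qzbar, pderiv_X]
  · simp [qzbar, pderiv_X, h]

lemma pdzbar_qz (l : Fin n → ℝ) (i j : Fin n) :
    pdzbar i (qz l j) = if i = j then 1 else 0 := by
  by_cases h : i = j
  · subst h; simp [qz, pderiv_X]
  · simp [qz, pderiv_X, h]

/-! ### Linear forms as prime polynomials -/

lemma prime_of_isHomogeneous_one {σ : Type*} {u : MvPolynomial σ ℂ} (hu : u.IsHomogeneous 1)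
    (h0 : u ≠ 0) : Prime u := by
  rw [← UniqueFactorizationMonoid.irreducible_iff_prime]
  refine irreducible_of_totalDegree_eq_one (hu.totalDegree h0) fun x hx => ?_
  obtain ⟨d, hd⟩ := MvPolynomial.ne_zero_iff.mp h0
  refine isUnit_iff_ne_zero.mpr ?_
  rintro rfl
  exact hd (zero_dvd_iff.mp (hx d))

lemma isHomogeneous_qz (l : Fin n → ℝ) (i : Fin n) : (qz l i).IsHomogeneous 1 :=
  (isHomogeneous_X _ _).add (isHomogeneous_C_mul_X _ _)

lemma isHomogeneous_qzbar (l : Fin n → ℝ) (i : Fin n) : (qzbar l i).IsHomogeneous 1 :=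
  (isHomogeneous_X _ _).add (isHomogeneous_C_mul_X _ _)

lemma qz_ne_zero (l : Fin n → ℝ) (i : Fin n) : qz l i ≠ 0 := fun h => by
  simpa [pdzbar_qz] using congrArg (pdzbar i) h

lemma qzbar_ne_zero (l : Fin n → ℝ) (i : Fin n) : qzbar l i ≠ 0 := fun h => by
  simpa [pdz_qzbar] using congrArg (pdz i) h

lemma prime_qz (l : Fin n → ℝ) (i : Fin n) : Prime (qz l i) :=
  prime_of_isHomogeneous_one (isHomogeneous_qz l i) (qz_ne_zero l i)

lemma prime_qzbar (l : Fin n → ℝ) (i : Fin n) : Prime (qzbar l i) :=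
  prime_of_isHomogeneous_one (isHomogeneous_qzbar l i) (qzbar_ne_zero l i)

/-- If `u` vanishes at a point where `M` does not, `u` does not divide `M`. -/
lemma not_dvd_of_eval {σ : Type*} {u M : MvPolynomial σ ℂ} (x : σ → ℂ) (hu : eval x u = 0)
    (hM : eval x M ≠ 0) : ¬ u ∣ M := by
  rintro ⟨v, rfl⟩
  simp [hu] at hM

/-- A prime `u` that does not divide `M` can be cancelled in `M ∣ u * D`. -/
lemma dvd_of_dvd_prime_mul {R : Type*} [CommRing R] [IsDomain R] {u M D : R} (hu : Prime u)
    (hM : ¬ u ∣ M) (h : M ∣ u * D) : M ∣ D := by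
  obtain ⟨k, hk⟩ := h
  obtain ⟨v, rfl⟩ := (hu.dvd_or_dvd ⟨D, hk.symm⟩).resolve_left hM
  exact ⟨v, mul_left_cancel₀ hu.ne_zero (by linear_combination hk)⟩

lemma not_qz_dvd_qz (l : Fin n → ℝ) {i j : Fin n} (h : i ≠ j) : ¬ qz l i ∣ qz l j := by
  refine not_dvd_of_eval (Sum.elim 0 (Pi.single j 1)) ?_ ?_ <;> simp [qz, h]

lemma not_qz_dvd_qzbar (l : Fin n → ℝ) {i j : Fin n} (h : i ≠ j) : ¬ qz l i ∣ qzbar l j := by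
  refine not_dvd_of_eval (Sum.elim (Pi.single j 1) 0) ?_ ?_ <;> simp [qz, qzbar, h]

lemma not_qzbar_dvd_qz (l : Fin n → ℝ) {i j : Fin n} (h : i ≠ j) : ¬ qzbar l i ∣ qz l j := by
  refine not_dvd_of_eval (Sum.elim 0 (Pi.single j 1)) ?_ ?_ <;> simp [qz, qzbar, h]

end Polynomials

/-! ### Multipliers -/
section Compatible

open MvPolynomial

variable {n : ℕ}

/-- The `k`-th coefficient `∂E/∂conj(z_k) - κ ∂q/∂conj(z_k)` of the antiholomorphic part of
`dE - κ dq`, where `q` is the quadric. -/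
def residue (l : Fin n → ℝ) (E κ : Poly n) (k : Fin n) : Poly n := pdzbar k E - κ * qzbar l k

/-- `κ` is a multiplier of `E`: the antiholomorphic part of `dE - κ dq` has coefficients that are
annihilated by all vector fields of type (1,0) tangent to the level sets of the quadric `q`.
If `E` is the real part of `f (z, q)`, the real part of `∂f/∂w (z, q)` is such a multiplier. -/
def IsMultiplier (l : Fin n → ℝ) (E κ : Poly n) : Prop :=
  ∀ i j k, qz l j * pdz i (residue l E κ k) = qz l i * pdz j (residue l E κ k)

/-- The restriction of the complex Hessian of `E` to the tangent vectors
`q_b ∂_j - q_j ∂_b` and `q_bbar ∂_kbar - q_kbar ∂_bbar`. -/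
def hess (l : Fin n → ℝ) (b : Fin n) (E : Poly n) (j k : Fin n) : Poly n :=
  qz l b * qzbar l b * pdz j (pdzbar k E) - qz l j * qzbar l b * pdz b (pdzbar k E)
    - qz l b * qzbar l k * pdz j (pdzbar b E) + qz l j * qzbar l k * pdz b (pdzbar b E)

/-- The restriction of the complex Hessian of the quadric to the same vectors, for `j` and `k`
different from `b` (see `hess_quadricPoly`). -/
def hessQuadric (l : Fin n → ℝ) (b j k : Fin n) : Poly n :=
  (if j = k then qz l b * qzbar l b else 0) + qz l j * qzbar l k

lemma IsMultiplier.sub {l : Fin n → ℝ} {E κ E' κ' : Poly n} (h : IsMultiplier l E κ)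
    (h' : IsMultiplier l E' κ') : IsMultiplier l (E - E') (κ - κ') := by
  intro i j k
  have e : residue l (E - E') (κ - κ') k = residue l E κ k - residue l E' κ' k := by
    simp only [residue, map_sub]; ring
  rw [e, map_sub, map_sub]
  linear_combination h i j k - h' i j k

lemma pdz_residue (l : Fin n → ℝ) (E κ : Poly n) (i k : Fin n) :
    pdz i (residue l E κ k) =
      pdz i (pdzbar k E) - pdz i κ * qzbar l k - if i = k then κ else 0 := by
  simp only [residue, map_sub, Derivation.leibniz, pdz_qzbar, smul_eq_mul]
  split_ifs <;> ring

/-- A multiplier is the quotient of the Hessians of `E` and of the quadric. -/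
lemma IsMultiplier.mul_hessQuadric {l : Fin n → ℝ} {E κ : Poly n} (h : IsMultiplier l E κ)
    {a b : Fin n} (hab : a ≠ b) : κ * hessQuadric l b a a = hess l b E a a := by
  have h1 := h a b a
  have h2 := h a b b
  rw [pdz_residue, pdz_residue] at h1 h2
  simp only [if_neg hab, if_neg hab.symm, if_true] at h1 h2
  simp only [hess, hessQuadric, if_true]
  linear_combination -(qzbar l b) * h1 + qzbar l a * h2

lemma hessQuadric_ne_zero (l : Fin n → ℝ) {a b : Fin n} (hab : a ≠ b) :
    hessQuadric l b a a ≠ 0 := fun h => by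
  simp only [hessQuadric, if_true] at h
  rcases (prime_qz l a).dvd_or_dvd (a := qz l b) (b := qzbar l b)
    ⟨-qzbar l a, by linear_combination h⟩ with h | h
  · exact not_qz_dvd_qz l hab h
  · exact not_qz_dvd_qzbar l hab h

/-- The multiplier `κ` of a real-valued `E` has itself a real-valued multiplier `κ'`. It arises
from comparing the Hessian of `E` with its conjugate, since the derivative of the residue of `E`
in the direction of `z_i` is a multiple of `∂q/∂z_i`. -/
lemma IsMultiplier.exists_multiplier {l : Fin n → ℝ} {E κ : Poly n} (h : IsMultiplier l E κ)
    (hE : pconj E = E) (hκ : pconj κ = κ) {a b : Fin n} (hab : a ≠ b) :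
    ∃ κ' : Poly n, pconj κ' = κ' ∧ IsMultiplier l κ κ' ∧
      ∀ i k, pdz i (residue l E κ k) = qz l i * residue l κ κ' k := by
  -- The linear form `qz l a` is prime and does not divide `qz l b`.
  have hβ : ∀ k, ∃ β, ∀ i, pdz i (residue l E κ k) = qz l i * β := by
    intro k
    obtain ⟨β, hβ⟩ := ((prime_qz l a).dvd_or_dvd ⟨_, h a b k⟩).resolve_left (not_qz_dvd_qz l hab)
    refine ⟨β, fun i => mul_left_cancel₀ (qz_ne_zero l a) ?_⟩
    rw [h i a k, hβ]
    ring
  choose β hβ using hβ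
  -- The mixed derivatives of `E` form a Hermitian matrix.
  have hsymm : ∀ i k, qzbar l k * (pdz i κ - pconj (β i)) = qz l i * (pdzbar k κ - β k) := by
    intro i k
    have h1 := hβ k i
    have h2 := congrArg pconj (hβ i k)
    rw [pdz_residue] at h1 h2
    simp only [map_sub, map_mul, apply_ite (pconj : Poly n → Poly n), pconj_pdz, pconj_pdzbar,
      pconj_qz, pconj_qzbar, hE, hκ, map_zero] at h2
    rw [pderiv_comm] at h2
    simp only [eq_comm (a := k) (b := i)] at h2
    linear_combination h2 - h1
  obtain ⟨c, hc⟩ := ((prime_qzbar l a).dvd_or_dvd ⟨_, (hsymm b a).symm⟩).resolve_left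
    (not_qzbar_dvd_qz l hab)
  have hc1 : ∀ i, pdz i κ - pconj (β i) = qz l i * c := fun i =>
    mul_left_cancel₀ (qzbar_ne_zero l a) (by rw [hsymm i a, hc]; ring)
  have hc2 : ∀ k, pdzbar k κ - β k = qzbar l k * c := fun k =>
    mul_left_cancel₀ (qz_ne_zero l a) (by rw [← hsymm a k, hc1]; ring)
  have hres : ∀ k, residue l κ c k = β k := fun k => by
    rw [residue]; linear_combination hc2 k
  refine ⟨c, ?_, fun i j k => ?_, fun i k => by rw [hres, hβ]⟩
  · have h1 := congrArg pconj (hc2 a)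
    simp only [map_sub, map_mul, pconj_pdzbar, pconj_qzbar, hκ] at h1
    exact mul_left_cancel₀ (qz_ne_zero l a) (by rw [← h1, hc1])
  · rw [hres]
    have h1 := pderiv_comm (Sum.inl j) (Sum.inl i) (residue l E κ k)
    rw [hβ k i, hβ k j] at h1
    simp only [Derivation.leibniz, pdz_qz, smul_eq_mul] at h1
    by_cases hij : i = j
    · subst hij; rfl
    · simp only [hij, Ne.symm hij, if_false, mul_zero, add_zero] at h1
      linear_combination -h1

lemma totalDegree_pderiv_le {σ : Type*} (i : σ) (f : MvPolynomial σ ℂ) :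
    (pderiv i f).totalDegree ≤ f.totalDegree - 1 := by
  refine Finset.sup_le fun m hm => ?_
  rw [mem_support_iff, coeff_pderiv] at hm
  have h := le_totalDegree (mem_support_iff.mpr (left_ne_zero_of_mul hm))
  rw [Finsupp.sum_add_index' (by simp) (by simp), Finsupp.sum_single_index rfl] at h
  omega

lemma isHomogeneous_hessQuadric (l : Fin n → ℝ) (b j k : Fin n) :
    (hessQuadric l b j k).IsHomogeneous 2 := by
  refine IsHomogeneous.add ?_ ((isHomogeneous_qz l j).mul (isHomogeneous_qzbar l k))
  split_ifs
  · exact (isHomogeneous_qz l b).mul (isHomogeneous_qzbar l b)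
  · exact isHomogeneous_zero _ _ _

/-- Truncated subtraction makes the bound equal to 2 for polynomials of degree at most 2. -/
lemma totalDegree_hess_le (l : Fin n → ℝ) (b j k : Fin n) (E : Poly n) :
    (hess l b E j k).totalDegree ≤ 2 + (E.totalDegree - 2) := by
  have key : ∀ u v : Poly n, u.IsHomogeneous 1 → v.IsHomogeneous 1 → ∀ i m,
      (u * v * pdz i (pdzbar m E)).totalDegree ≤ 2 + (E.totalDegree - 2) := fun u v hu hv i m =>
    (totalDegree_mul _ _).trans (add_le_add (hu.mul hv).totalDegree_le
      ((totalDegree_pderiv_le _ _).trans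
        ((Nat.sub_le_sub_right (totalDegree_pderiv_le _ _) 1).trans_eq (Nat.sub_sub _ _ _))))
  have hq := isHomogeneous_qz l
  have hq' := isHomogeneous_qzbar l
  refine (totalDegree_add _ _).trans (max_le ((totalDegree_sub _ _).trans (max_le
    ((totalDegree_sub _ _).trans (max_le ?_ ?_)) ?_)) ?_) <;>
  exact key _ _ (hq _) (hq' _) _ _

/-- The multiplier has smaller degree: multiplied by a quadratic polynomial it is the Hessian
of `E`, which has at most the degree of `E`. -/
lemma IsMultiplier.totalDegree_lt {l : Fin n → ℝ} {E κ : Poly n} (h : IsMultiplier l E κ)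
    {a b : Fin n} (hab : a ≠ b) (hκ : κ ≠ 0) : κ.totalDegree < E.totalDegree := by
  have h0 := h.mul_hessQuadric hab
  have h1 := totalDegree_hess_le l b a a E
  rw [← h0, totalDegree_mul_of_isDomain hκ (hessQuadric_ne_zero l hab),
    (isHomogeneous_hessQuadric l b a a).totalDegree (hessQuadric_ne_zero l hab)] at h1
  by_contra! hlt
  have hE : E.totalDegree = 0 := by omega
  obtain ⟨c, rfl⟩ : ∃ c, E = C c := ⟨_, totalDegree_eq_zero_iff_eq_C.mp hE⟩
  have : hess l b (C c) a a = 0 := by simp [hess]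
  rw [this] at h0
  exact (mul_ne_zero hκ (hessQuadric_ne_zero l hab)) h0

/-- A real-valued polynomial with multiplier zero is pluriharmonic. -/
lemma IsMultiplier.pluriharmonic {l : Fin n → ℝ} {E : Poly n} (h : IsMultiplier l E 0)
    (hE : pconj E = E) {a b : Fin n} (hab : a ≠ b) (i k : Fin n) : pdz i (pdzbar k E) = 0 := by
  obtain ⟨κ', -, h1, h2⟩ := h.exists_multiplier hE (map_zero _) hab
  have h3 := h1.mul_hessQuadric hab
  have h4 : κ' = 0 := by
    refine (mul_eq_zero.mp (h3.trans ?_)).resolve_right (hessQuadric_ne_zero l hab)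
    simp [hess]
  simpa [residue, h4] using h2 i k

end Compatible

/-! ### Real parts of polynomials in `z` and the quadric -/
section Plug

open MvPolynomial

variable {n : ℕ}

/-- The quadric as a polynomial. -/
def quadricPoly (l : Fin n → ℝ) : Poly n :=
  ∑ i, (X (Sum.inl i) * X (Sum.inr i) + C (l i : ℂ) * (X (Sum.inl i) ^ 2 + X (Sum.inr i) ^ 2))

/-- The substitution `f (z, w) ↦ f (z, q)`, where `q` is the quadric. -/
def plug (l : Fin n → ℝ) : MvPolynomial (Fin n ⊕ Unit) ℂ →ₐ[ℂ] Poly n :=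
  aeval (Sum.elim (fun i => X (Sum.inl i)) fun _ => quadricPoly l)

@[simp] lemma pconj_quadricPoly (l : Fin n → ℝ) : pconj (quadricPoly l) = quadricPoly l := by
  simp only [quadricPoly, map_sum, map_add, map_mul, map_pow, pconj_X_inl, pconj_X_inr, pconj_C,
    Complex.conj_ofReal]
  exact Finset.sum_congr rfl fun i _ => by ring

lemma pdz_quadricPoly (l : Fin n → ℝ) (j : Fin n) : pdz j (quadricPoly l) = qz l j := by
  classical
  have : ∀ i, pdz j (X (Sum.inl i) * X (Sum.inr i) +
      C (l i : ℂ) * (X (Sum.inl i) ^ 2 + X (Sum.inr i) ^ 2) : Poly n) =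
      if j = i then qz l j else 0 := by
    intro i
    by_cases h : j = i
    · subst h
      simp [qz, pderiv_X, pow_two, Derivation.leibniz, map_ofNat (C : ℂ →+* Poly n) 2]
      ring
    · simp [pderiv_X, h, Derivation.leibniz]
  rw [quadricPoly, map_sum, Finset.sum_congr rfl fun i _ => this i]
  simp

lemma pdzbar_quadricPoly (l : Fin n → ℝ) (j : Fin n) : pdzbar j (quadricPoly l) = qzbar l j := by
  rw [← pconj_qz, ← pdz_quadricPoly, pconj_pdz, pconj_quadricPoly]

/-- The chain rule for a polynomial in finitely many elements of an algebra and one more. -/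
lemma derivation_aeval_sumElim {A : Type*} [CommRing A] [Algebra ℂ A] (D : Derivation ℂ A A)
    (g : Fin n → A) (r : A) (f : MvPolynomial (Fin n ⊕ Unit) ℂ) :
    D (aeval (Sum.elim g fun _ => r) f) =
      ∑ i, aeval (Sum.elim g fun _ => r) (pderiv (Sum.inl i) f) * D (g i) +
        aeval (Sum.elim g fun _ => r) (pderiv (Sum.inr ()) f) * D r := by
  classical
  induction f using MvPolynomial.induction_on with
  | C a => simp
  | add p q hp hq =>
    simp only [map_add, hp, hq, add_mul, Finset.sum_add_distrib]
    ring
  | mul_X p i hp =>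
    simp only [map_mul, Derivation.leibniz, hp, smul_eq_mul, map_add, aeval_X, add_mul, pderiv_X,
      Finset.sum_add_distrib]
    rcases i with i | i
    · simp only [Sum.elim_inl, Pi.single_apply, Sum.inl.injEq, reduceCtorEq, if_false, map_zero,
        mul_zero, zero_mul, apply_ite (aeval (Sum.elim g fun _ => r)), map_one, mul_ite, mul_one,
        ite_mul, Finset.sum_ite_eq, Finset.mem_univ, if_true, mul_add, Finset.mul_sum, mul_assoc]
      ring
    · simp only [Sum.elim_inr, Pi.single_apply, reduceCtorEq, if_false, map_zero,
        mul_zero, zero_mul, map_one, mul_one, if_true, mul_add, Finset.mul_sum,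
        mul_assoc, Finset.sum_const_zero]
      ring

lemma pdz_plug (l : Fin n → ℝ) (j : Fin n) (f : MvPolynomial (Fin n ⊕ Unit) ℂ) :
    pdz j (plug l f) = plug l (pderiv (Sum.inl j) f) + plug l (pderiv (Sum.inr ()) f) * qz l j := by
  classical
  rw [plug, derivation_aeval_sumElim, pdz_quadricPoly]
  simp [pderiv_X, Pi.single_apply]

lemma pdzbar_plug (l : Fin n → ℝ) (j : Fin n) (f : MvPolynomial (Fin n ⊕ Unit) ℂ) :
    pdzbar j (plug l f) = plug l (pderiv (Sum.inr ()) f) * qzbar l j := by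
  classical
  rw [plug, derivation_aeval_sumElim, pdzbar_quadricPoly]
  simp [pderiv_X]

lemma exists_pderiv_eq {σ : Type*} (i : σ) (g : MvPolynomial σ ℂ) :
    ∃ f : MvPolynomial σ ℂ, pderiv i f = g := by
  classical
  induction g using MvPolynomial.induction_on' with
  | monomial d c =>
    refine ⟨monomial (d + Finsupp.single i 1) (c / (d i + 1)), ?_⟩
    rw [pderiv_monomial]
    have : (d i : ℂ) + 1 ≠ 0 := Nat.cast_add_one_ne_zero _
    simp [this]
  | add p q hp hq =>
    obtain ⟨f, rfl⟩ := hp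
    obtain ⟨g, rfl⟩ := hq
    exact ⟨f + g, map_add _ _ _⟩

/-- The real part (up to the factor 2) of `f (z, q)` has the real part of `∂f/∂w (z, q)` as a
multiplier. -/
lemma isMultiplier_plug (l : Fin n → ℝ) (f : MvPolynomial (Fin n ⊕ Unit) ℂ) :
    IsMultiplier l (plug l f + pconj (plug l f))
      (plug l (pderiv (Sum.inr ()) f) + pconj (plug l (pderiv (Sum.inr ()) f))) := by
  have h : ∀ i k, pdz i (residue l (plug l f + pconj (plug l f))
      (plug l (pderiv (Sum.inr ()) f) + pconj (plug l (pderiv (Sum.inr ()) f))) k) =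
      qz l i * pconj (plug l (pderiv (Sum.inr ()) (pderiv (Sum.inl k) f))) := by
    intro i k
    have : residue l (plug l f + pconj (plug l f))
        (plug l (pderiv (Sum.inr ()) f) + pconj (plug l (pderiv (Sum.inr ()) f))) k =
        pconj (plug l (pderiv (Sum.inl k) f)) := by
      rw [residue, map_add, pdzbar_plug, ← pconj_pdz, pdz_plug]
      simp only [map_add, map_mul, pconj_qz]
      ring
    rw [this, ← pconj_pdzbar, pdzbar_plug, map_mul, pconj_qzbar, mul_comm]
  intro i j k
  rw [h, h]
  ring

lemma exists_plug_of_supported (l : Fin n → ℝ) {p : Poly n} (hp : p ∈ supported ℂ (Set.range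
    (Sum.inl : Fin n → Fin n ⊕ Fin n))) : ∃ f, p = plug l f := by
  rw [supported_eq_adjoin_X] at hp
  have : Algebra.adjoin ℂ (X '' Set.range (Sum.inl : Fin n → Fin n ⊕ Fin n)) ≤ (plug l).range := by
    refine Algebra.adjoin_le ?_
    rintro _ ⟨_, ⟨i, rfl⟩, rfl⟩
    exact ⟨X (Sum.inl i), by simp [plug]⟩
  obtain ⟨f, hf⟩ := this hp
  exact ⟨f, hf.symm⟩

lemma pconj_mem_supported {p : Poly n} (hp : p ∈ supported ℂ (Set.range
    (Sum.inr : Fin n → Fin n ⊕ Fin n))) : pconj p ∈ supported ℂ (Set.range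
    (Sum.inl : Fin n → Fin n ⊕ Fin n)) := by
  rw [supported_eq_adjoin_X] at hp
  induction hp using Algebra.adjoin_induction with
  | mem x hx =>
    obtain ⟨_, ⟨i, rfl⟩, rfl⟩ := hx
    rw [pconj_X_inr, X_mem_supported]
    exact ⟨i, rfl⟩
  | algebraMap r =>
    rw [algebraMap_eq, pconj_C]
    exact Subalgebra.algebraMap_mem _ _
  | add x y _ _ hx hy => rw [map_add]; exact add_mem hx hy
  | mul x y _ _ hx hy => rw [map_mul]; exact mul_mem hx hy

/-- A polynomial that is the sum of some `f (z, q)` and a conjugate of some `g (z, q)` is a real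
part if it is real-valued. -/
lemma exists_plug_of_real (l : Fin n → ℝ) {E : Poly n} (hE : pconj E = E)
    {f g : MvPolynomial (Fin n ⊕ Unit) ℂ} (h : E = plug l f + pconj (plug l g)) :
    ∃ f, E = plug l f + pconj (plug l f) := by
  refine ⟨C (1 / 2) * (f + g), ?_⟩
  have h2 : E = plug l g + pconj (plug l f) := by
    rw [← hE, h]; simp [add_comm]
  have hC : (C (1 / 2) : Poly n) + C (1 / 2) = 1 := by rw [← map_add]; norm_num
  have hP : plug l (C (1 / 2)) = C (1 / 2) := by simp [plug, algHom_C]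
  have hK : pconj (C (1 / 2) : Poly n) = C (1 / 2) := by
    rw [pconj_C]; simp [map_ofNat (starRingEnd ℂ) 2]
  simp only [map_mul, map_add, hP, hK]
  linear_combination (-E) * hC + C (1 / 2) * h + C (1 / 2) * h2

/-- A real-valued pluriharmonic polynomial is the real part of a holomorphic one. -/
lemma exists_plug_of_pluriharmonic (l : Fin n → ℝ) {E : Poly n} (hE : pconj E = E)
    (h : ∀ i k, pdz i (pdzbar k E) = 0) : ∃ f, E = plug l f + pconj (plug l f) := by
  classical
  have hm : ∀ d ∈ E.support, ∃ f g, monomial d (coeff d E) = plug l f + pconj (plug l g) := by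
    intro d hd
    by_cases hi : ∃ i, d (Sum.inl i) ≠ 0
    · obtain ⟨i, hi⟩ := hi
      have hz : ∀ k, d (Sum.inr k) = 0 := by
        intro k
        by_contra hk
        have h1 := congrArg
          (coeff (d - Finsupp.single (Sum.inr k) 1 - Finsupp.single (Sum.inl i) 1)) (h i k)
        have h2 : d - Finsupp.single (Sum.inr k) 1 - Finsupp.single (Sum.inl i) 1 +
            Finsupp.single (Sum.inl i) 1 + Finsupp.single (Sum.inr k) 1 = d := by
          ext x
          simp only [Finsupp.add_apply, Finsupp.tsub_apply, Finsupp.single_apply]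
          split_ifs with h3 h4 h4
          · subst h4; simp at h3
          · subst h3; omega
          · subst h4; omega
          · omega
        rw [coeff_pderiv, coeff_pderiv, h2, coeff_zero, mul_assoc] at h1
        refine (mul_ne_zero (mem_support_iff.mp hd) (mul_ne_zero ?_ ?_)) h1 <;>
        exact Nat.cast_add_one_ne_zero _
      obtain ⟨f, hf⟩ := exists_plug_of_supported l (p := monomial d (coeff d E)) (by
        rw [mem_supported, vars_monomial (mem_support_iff.mp hd)]
        rintro (x | x) hx
        · exact ⟨x, rfl⟩
        · exact absurd (hz x) (Finsupp.mem_support_iff.mp hx))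
      exact ⟨f, 0, by simp [hf]⟩
    · push Not at hi
      obtain ⟨f, hf⟩ := exists_plug_of_supported l (p := pconj (monomial d (coeff d E)))
        (pconj_mem_supported (by
          rw [mem_supported, vars_monomial (mem_support_iff.mp hd)]
          rintro (x | x) hx
          · exact absurd (hi x) (Finsupp.mem_support_iff.mp hx)
          · exact ⟨x, rfl⟩))
      exact ⟨0, f, by simp [← hf]⟩
  choose! f g hfg using hm
  refine exists_plug_of_real l hE (f := ∑ d ∈ E.support, f d) (g := ∑ d ∈ E.support, g d) ?_
  conv_lhs => rw [as_sum E]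
  simp only [map_sum, ← Finset.sum_add_distrib]
  exact Finset.sum_congr rfl hfg

/-- A real-valued polynomial with a real-valued multiplier is the real part of some `f (z, q)`. -/
theorem IsMultiplier.exists_plug {l : Fin n → ℝ} {a b : Fin n} (hab : a ≠ b) {E κ : Poly n}
    (h : IsMultiplier l E κ) (hE : pconj E = E) (hκ : pconj κ = κ) :
    ∃ f, E = plug l f + pconj (plug l f) := by
  induction hd : E.totalDegree using Nat.strong_induction_on generalizing E κ with
  | _ d ih =>
    have hharm : ∀ E : Poly n, IsMultiplier l E 0 → pconj E = E →
        ∃ f, E = plug l f + pconj (plug l f) := fun E h hE =>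
      exists_plug_of_pluriharmonic l hE fun i k => h.pluriharmonic hE hab i k
    by_cases h0 : κ = 0
    · exact hharm E (h0 ▸ h) hE
    · obtain ⟨κ', hκ', hm, -⟩ := h.exists_multiplier hE hκ hab
      obtain ⟨g, hg⟩ := ih _ (hd ▸ h.totalDegree_lt hab h0) hm hκ hκ' rfl
      obtain ⟨f, rfl⟩ := exists_pderiv_eq (Sum.inr ()) g
      have h1 := h.sub (isMultiplier_plug l f)
      rw [← hg, sub_self] at h1
      obtain ⟨f', hf'⟩ := hharm _ h1 (by simp [hE, add_comm])
      exact ⟨f + f', by simp only [map_add]; linear_combination hf'⟩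

end Plug

/-! ### Divisibility of the Hessian -/
section Divisibility

open MvPolynomial

variable {n : ℕ}

/-- The vector field `∂q/∂z_b ∂/∂z_j - ∂q/∂z_j ∂/∂z_b`, tangent to the level sets of the
quadric `q`. -/
def tangential (l : Fin n → ℝ) (b j : Fin n) : Derivation ℂ (Poly n) (Poly n) :=
  qz l b • pdz j - qz l j • pdz b

lemma tangential_apply (l : Fin n → ℝ) (b j : Fin n) (f : Poly n) :
    tangential l b j f = qz l b * pdz j f - qz l j * pdz b f := rfl

lemma pconj_hessQuadric (l : Fin n → ℝ) (b j k : Fin n) :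
    pconj (hessQuadric l b j k) = hessQuadric l b k j := by
  simp only [hessQuadric, map_add, map_mul, apply_ite (pconj : Poly n → Poly n), pconj_qz,
    pconj_qzbar, map_zero, eq_comm (a := j) (b := k)]
  split_ifs <;> ring

lemma pconj_hess (l : Fin n → ℝ) (b j k : Fin n) {E : Poly n} (hE : pconj E = E) :
    pconj (hess l b E j k) = hess l b E k j := by
  have h : ∀ i m, pconj (pdz i (pdzbar m E)) = pdz m (pdzbar i E) := fun i m => by
    rw [pconj_pdz, pconj_pdzbar, hE, pderiv_comm]
  simp only [hess, map_sub, map_add, map_mul, pconj_qz, pconj_qzbar, h]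
  ring

lemma hessQuadric_self (l : Fin n → ℝ) (b a : Fin n) :
    hessQuadric l b a a = qz l b * qzbar l b + qz l a * qzbar l a := by
  simp [hessQuadric]

lemma not_qz_dvd_hessQuadric (l : Fin n → ℝ) {a b : Fin n} (hab : a ≠ b) :
    ¬ qz l a ∣ hessQuadric l b a a := by
  rw [hessQuadric_self]
  intro h
  rcases (prime_qz l a).dvd_or_dvd ((dvd_add_left (dvd_mul_right _ _)).mp h) with h | h
  · exact not_qz_dvd_qz l hab h
  · exact not_qz_dvd_qzbar l hab h

lemma hessQuadric_swap (l : Fin n → ℝ) (b a : Fin n) :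
    hessQuadric l b a a = hessQuadric l a b b := by
  simp only [hessQuadric_self]; ring

lemma not_qzbar_dvd_hessQuadric (l : Fin n → ℝ) {a b : Fin n} (hab : a ≠ b) :
    ¬ qzbar l a ∣ hessQuadric l b a a := fun h =>
  not_qz_dvd_hessQuadric l hab (by simpa [pconj_hessQuadric] using map_dvd pconj h)

lemma not_qzbar_dvd_hessQuadric_of_ne {l : Fin n → ℝ} (hl : ∀ i, 0 ≤ l i) {a b c : Fin n}
    (hab : a ≠ b) (hca : c ≠ a) : ¬ qzbar l c ∣ hessQuadric l b a a := by
  refine not_dvd_of_eval (Sum.elim (Pi.single a 1) (Pi.single a 1)) ?_ ?_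
  · simp [qzbar, hca]
  · have h : (1 + 2 * l a) * (1 + 2 * l a) ≠ 0 := by have := hl a; positivity
    simp only [hessQuadric_self, qz, qzbar, map_add, map_mul, eval_X, eval_C, Sum.elim_inl,
      Sum.elim_inr, Pi.single_eq_same, Pi.single_eq_of_ne hab.symm]
    exact_mod_cast (by simpa using h)

section TwoVariables

variable {l : Fin n → ℝ} {a b : Fin n} {E : Poly n}

lemma tangential_qz_left (hab : a ≠ b) :
    tangential l b a (qz l a) = C (2 * (l a : ℂ)) * qz l b := by
  simp [tangential_apply, pdz_qz, hab.symm, -map_mul, mul_comm]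

lemma tangential_qz_right (hab : a ≠ b) :
    tangential l b a (qz l b) = -(C (2 * (l b : ℂ)) * qz l a) := by
  simp [tangential_apply, pdz_qz, hab, -map_mul, mul_comm]

lemma tangential_qzbar_left (hab : a ≠ b) : tangential l b a (qzbar l a) = qz l b := by
  simp [tangential_apply, pdz_qzbar, hab.symm]

lemma tangential_qzbar_right (hab : a ≠ b) : tangential l b a (qzbar l b) = -qz l a := by
  simp [tangential_apply, pdz_qzbar, hab]

lemma tangential_hessQuadric (hab : a ≠ b) :
    tangential l b a (hessQuadric l b a a) =
      C (2 * (l a : ℂ)) * (qz l b * qzbar l a) - C (2 * (l b : ℂ)) * (qz l a * qzbar l b) := by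
  simp only [hessQuadric_self, map_add, Derivation.leibniz, tangential_qz_left hab,
    tangential_qz_right hab, tangential_qzbar_left hab, tangential_qzbar_right hab, smul_eq_mul]
  ring

/-- The condition that the `conj (z_b)`-component of the residue of `E`, with the quotient of the
two Hessians as multiplier, is annihilated by the tangential vector field; denominators are
cleared. -/
def ResidueIdentity (l : Fin n → ℝ) (a b : Fin n) (E : Poly n) : Prop :=
  tangential l b a (pdzbar b E * hessQuadric l b a a - qzbar l b * hess l b E a a) *
      hessQuadric l b a a =
    (pdzbar b E * hessQuadric l b a a - qzbar l b * hess l b E a a) *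
      tangential l b a (hessQuadric l b a a)

/-- The numerator of the tangential derivative of the quotient of the two Hessians is divisible by
the Hessian of the quadric. -/
lemma ResidueIdentity.exists_quotient (hab : a ≠ b) (h : ResidueIdentity l a b E) :
    ∃ V, hessQuadric l b a a * tangential l b a (hess l b E a a) -
        hess l b E a a * tangential l b a (hessQuadric l b a a) = hessQuadric l b a a * V ∧
      qzbar l b * V = hessQuadric l b a a * tangential l b a (pdzbar b E) +
        qz l a * hess l b E a a := by
  simp only [ResidueIdentity, map_sub, Derivation.leibniz, tangential_qzbar_right hab,
    smul_eq_mul] at h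
  have h1 : qzbar l b * (hessQuadric l b a a * tangential l b a (hess l b E a a) -
      hess l b E a a * tangential l b a (hessQuadric l b a a)) =
      hessQuadric l b a a * (hessQuadric l b a a * tangential l b a (pdzbar b E) +
        qz l a * hess l b E a a) := by linear_combination -h
  obtain ⟨V, hV⟩ := dvd_of_dvd_prime_mul (prime_qzbar l b)
    (hessQuadric_swap l b a ▸ not_qzbar_dvd_hessQuadric l hab.symm) ⟨_, h1⟩
  refine ⟨V, hV, mul_left_cancel₀ (hessQuadric_ne_zero l hab) ?_⟩
  rw [← h1, hV]
  ring

/-- The ideal of all `g` such that the Hessian of the quadric divides `g` times the Hessian of `E`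
is stable under the tangential vector field. -/
lemma ResidueIdentity.dvd_tangential_mul (hab : a ≠ b) (h : ResidueIdentity l a b E) {g : Poly n}
    (hg : hessQuadric l b a a ∣ g * hess l b E a a) :
    hessQuadric l b a a ∣ tangential l b a g * hess l b E a a := by
  obtain ⟨V, h1, h2⟩ := h.exists_quotient hab
  obtain ⟨k, hk⟩ := hg
  have h3 : hessQuadric l b a a ∣ g * V := by
    refine dvd_of_dvd_prime_mul (prime_qzbar l b)
      (hessQuadric_swap l b a ▸ not_qzbar_dvd_hessQuadric l hab.symm)
      ⟨g * tangential l b a (pdzbar b E) + qz l a * k, ?_⟩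
    linear_combination g * h2 + qz l a * hk
  obtain ⟨m, hm⟩ := h3
  refine ⟨tangential l b a k - m, mul_left_cancel₀ (hessQuadric_ne_zero l hab) ?_⟩
  have h4 := congrArg (tangential l b a) hk
  simp only [Derivation.leibniz, smul_eq_mul] at h4
  linear_combination hessQuadric l b a a * h4 - g * h1 - hessQuadric l b a a * hm -
    tangential l b a (hessQuadric l b a a) * hk

/-- The tangential derivative of the Hessian of the quadric and its conjugate are combinations of
`q_b q_abar` and `q_a q_bbar` with determinant a multiple of `l a ^ 2 - l b ^ 2`. -/
lemma ResidueIdentity.dvd_of_coeff_ne (hab : a ≠ b) (h : ResidueIdentity l a b E) (hE : pconj E = E)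
    (hl : ∀ i, 0 ≤ l i) (hne : l a ≠ l b) : hessQuadric l b a a ∣ hess l b E a a := by
  have h1 := h.dvd_tangential_mul hab (dvd_mul_right _ _)
  rw [tangential_hessQuadric hab] at h1
  have h2 := map_dvd pconj h1
  simp only [map_mul, map_sub, pconj_qz, pconj_qzbar, pconj_hess _ _ _ _ hE, pconj_hessQuadric,
    pconj_C, Complex.conj_ofReal, map_ofNat (starRingEnd ℂ) 2] at h1 h2
  have h3 : hessQuadric l b a a ∣ qz l b * (qzbar l a * hess l b E a a) := by
    have h4 := dvd_add (h1.mul_left (C (l a : ℂ))) (h2.mul_left (C (l b : ℂ)))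
    -- Distinct nonnegative coefficients have distinct squares.
    have h5 : (2 : ℂ) * (l a * l a - l b * l b) ≠ 0 := by
      have ha := hl a
      have hb := hl b
      have : l a * l a - l b * l b ≠ 0 := fun h0 => by
        rcases mul_eq_zero.mp (show (l a - l b) * (l a + l b) = 0 by linear_combination h0) with
          h0 | h0
        · exact hne (by linarith)
        · exact hne (by linarith)
      exact_mod_cast (mul_ne_zero two_ne_zero this)
    have h6 : C ((2 : ℂ) * (l a * l a - l b * l b))⁻¹ * C ((2 : ℂ) * (l a * l a - l b * l b)) =
        (1 : Poly n) := by rw [← map_mul, inv_mul_cancel₀ h5, map_one]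
    refine (h4.mul_left (C ((2 : ℂ) * (l a * l a - l b * l b))⁻¹)).trans (dvd_of_eq ?_)
    simp only [map_mul, map_sub] at h6
    linear_combination (qz l b * (qzbar l a * hess l b E a a)) * h6
  refine dvd_of_dvd_prime_mul (prime_qzbar l a) (not_qzbar_dvd_hessQuadric l hab)
    (dvd_of_dvd_prime_mul (prime_qz l b) ?_ h3)
  rw [hessQuadric_swap]
  exact not_qz_dvd_hessQuadric l hab.symm

/-- For `l a = l b = r`, the linear forms `q_a ± i q_b` do not divide the Hessian of the quadric
unless `r = 1 / 2`. -/
lemma prime_and_not_dvd_of_eq (hab : a ≠ b) (heq : l a = l b) (hhalf : l a ≠ 1 / 2)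
    (hl : 0 ≤ l a) {ε : ℂ} (hε : ε * ε = -1) : Prime (qz l a + C ε * qz l b) ∧
      ¬ (qz l a + C ε * qz l b) ∣ hessQuadric l b a a := by
  constructor
  · refine prime_of_isHomogeneous_one ((isHomogeneous_qz l a).add ((isHomogeneous_qz l b).C_mul ε))
      fun h => ?_
    simpa [pdzbar_qz, hab] using congrArg (pdzbar a) h
  -- At this point `q_a = -ε`, `q_b = 1` and the Hessian of the quadric equals `1 - 4 r ^ 2`.
  · refine not_dvd_of_eval (Sum.elim (Pi.single b 1)
      (Pi.single a (-ε) + Pi.single b (1 - 2 * (l b : ℂ)))) ?_ ?_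
    · simp [qz, hab, hab.symm]
    · have h1 : (1 : ℂ) - 4 * (l b * l b) ≠ 0 := by
        rw [heq] at hhalf hl
        have : (1 : ℝ) - 4 * (l b * l b) ≠ 0 := fun h0 => by
          rcases mul_eq_zero.mp (show (1 - 2 * l b) * (1 + 2 * l b) = 0 by linear_combination h0)
            with h0 | h0
          · exact hhalf (by linarith)
          · linarith
        exact_mod_cast this
      simp [hessQuadric_self, qz, qzbar, hab, hab.symm, heq]
      intro h0
      apply h1
      linear_combination h0 - 2 * (l b : ℂ) * hε

/-- Differentiating the Hessian of the quadric twice along the tangential vector field gives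
`q_a ^ 2 + q_b ^ 2`, up to a multiple of this Hessian; this is a product of two linear forms. -/
lemma ResidueIdentity.dvd_of_coeff_eq (hab : a ≠ b) (h : ResidueIdentity l a b E)
    (hl : ∀ i, 0 ≤ l i) (heq : l a = l b) (hhalf : l a ≠ 1 / 2) (h0 : l a ≠ 0) :
    hessQuadric l b a a ∣ hess l b E a a := by
  have h1 := h.dvd_tangential_mul hab (dvd_mul_right _ _)
  have h2 : hessQuadric l b a a ∣
      (qz l b * qzbar l a - qz l a * qzbar l b) * hess l b E a a := by
    have h3 : (2 : ℂ) * l b ≠ 0 := by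
      rw [← heq]; exact mul_ne_zero two_ne_zero (by exact_mod_cast h0)
    have h6 : C ((2 : ℂ) * l b)⁻¹ * C ((2 : ℂ) * l b) = (1 : Poly n) := by
      rw [← map_mul, inv_mul_cancel₀ h3, map_one]
    refine (h1.mul_left (C ((2 : ℂ) * l b)⁻¹)).trans (dvd_of_eq ?_)
    rw [tangential_hessQuadric hab, heq]
    linear_combination
      ((qz l b * qzbar l a - qz l a * qzbar l b) * hess l b E a a) * h6
  have h3 := h.dvd_tangential_mul hab h2
  have hI : C Complex.I * C Complex.I = (-1 : Poly n) := by
    rw [← map_mul, Complex.I_mul_I, map_neg, map_one]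
  have h4 : hessQuadric l b a a ∣ (qz l a + C Complex.I * qz l b) *
      ((qz l a + C (-Complex.I) * qz l b) * hess l b E a a) := by
    refine (dvd_add h3 ((dvd_mul_right (hessQuadric l b a a)
      (C (2 * (l b : ℂ)) * hess l b E a a)))).trans (dvd_of_eq ?_)
    simp only [map_sub, Derivation.leibniz, tangential_qz_left hab, tangential_qz_right hab,
      tangential_qzbar_left hab, tangential_qzbar_right hab, smul_eq_mul, heq, hessQuadric_self,
      map_neg]
    linear_combination (qz l b ^ 2 * hess l b E a a) * hI
  have p1 := prime_and_not_dvd_of_eq hab heq hhalf (hl a) Complex.I_mul_I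
  have p2 := prime_and_not_dvd_of_eq hab heq hhalf (hl a) (ε := -Complex.I) (by simp)
  exact dvd_of_dvd_prime_mul p2.1 p2.2 (dvd_of_dvd_prime_mul p1.1 p1.2 h4)

lemma coeff_X_mul_pderiv {σ : Type*} (i : σ) (f : MvPolynomial σ ℂ) (d : σ →₀ ℕ) :
    coeff d (X i * pderiv i f) = d i * coeff d f := by
  classical
  induction f using MvPolynomial.induction_on' with
  | monomial e c =>
    rw [X_mul_pderiv_monomial, coeff_smul, coeff_monomial]
    split_ifs with h
    · subst h; simp
    · simp
  | add p q hp hq => rw [map_add, mul_add, coeff_add, coeff_add, hp, hq]; ring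

/-- The operator `z_a ∂/∂z_a + z_b ∂/∂z_b + (m + 1)` is bijective, since the monomials are
eigenvectors with positive eigenvalues. -/
lemma euler_bijective (a b : Fin n) (m : ℕ) : Function.Bijective fun f : Poly n =>
    X (Sum.inl a) * pdz a f + X (Sum.inl b) * pdz b f + ((m + 1 : ℕ) : Poly n) * f := by
  constructor
  · intro f g hfg
    ext d
    have h := congrArg (coeff d) hfg
    simp only [coeff_add, coeff_X_mul_pderiv, ← map_natCast (C : ℂ →+* Poly n), coeff_C_mul] at h
    have h0 : (d (Sum.inl a) : ℂ) + d (Sum.inl b) + ((m + 1 : ℕ) : ℂ) ≠ 0 := by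
      norm_cast
    exact mul_left_cancel₀ h0 (by linear_combination h)
  · intro f
    induction f using MvPolynomial.induction_on' with
    | monomial e c =>
      have h0 : (e (Sum.inl a) : ℂ) + e (Sum.inl b) + ((m + 1 : ℕ) : ℂ) ≠ 0 := by
        norm_cast
      refine ⟨monomial e (c / (e (Sum.inl a) + e (Sum.inl b) + ((m + 1 : ℕ) : ℂ))), ?_⟩
      classical
      ext d
      simp only [coeff_add, coeff_X_mul_pderiv, ← map_natCast (C : ℂ →+* Poly n), coeff_C_mul,
        coeff_monomial]
      split_ifs with h
      · subst h
        field_simp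
      · simp
    | add p q hp hq =>
      obtain ⟨f, rfl⟩ := hp
      obtain ⟨g, rfl⟩ := hq
      exact ⟨f + g, by simp only [map_add]; ring⟩

/-- For `l a = l b = 0` the Hessian of the quadric is `M = |z_a| ^ 2 + |z_b| ^ 2`, and it divides
`D + z_a ∂D/∂z_a + z_b ∂D/∂z_b`, where `D` is the Hessian of `E`. As the Euler operator preserves
the multiples of `M`, it divides `D`. -/
lemma ResidueIdentity.dvd_of_coeff_zero (hab : a ≠ b) (h : ResidueIdentity l a b E)
    (ha : l a = 0) (hb : l b = 0) : hessQuadric l b a a ∣ hess l b E a a := by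
  obtain ⟨V, h1, h2⟩ := h.exists_quotient hab
  have hz : tangential l b a (hessQuadric l b a a) = 0 := by
    rw [tangential_hessQuadric hab]; simp [ha, hb]
  rw [hz, mul_zero, sub_zero] at h1
  rw [← mul_left_cancel₀ (hessQuadric_ne_zero l hab) h1, tangential_apply] at h2
  have hM : hessQuadric l b a a =
      X (Sum.inr b) * X (Sum.inl b) + X (Sum.inr a) * X (Sum.inl a) := by
    simp [hessQuadric_self, qz, qzbar, ha, hb]
  have hqa : qz l a = X (Sum.inr a) := by simp [qz, ha]
  have hqb : qz l b = X (Sum.inr b) := by simp [qz, hb]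
  have htb : qzbar l b = X (Sum.inl b) := by simp [qzbar, hb]
  obtain ⟨R, hR⟩ : hessQuadric l b a a ∣ X (Sum.inl a) * pdz a (hess l b E a a) +
      X (Sum.inl b) * pdz b (hess l b E a a) + ((0 + 1 : ℕ) : Poly n) * hess l b E a a := by
    refine dvd_of_dvd_prime_mul (prime_qz l a) (not_qz_dvd_hessQuadric l hab)
      ⟨pdz a (hess l b E a a) - tangential l b a (pdzbar b E), ?_⟩
    rw [hqa, hqb, htb] at h2
    rw [hqa]
    push_cast
    linear_combination -h2 - pdz a (hess l b E a a) * hM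
  obtain ⟨S, rfl⟩ := (euler_bijective a b 1).2 R
  refine ⟨S, (euler_bijective a b 0).1 ?_⟩
  have e1 : pdz a (hessQuadric l b a a) = X (Sum.inr a) := by
    simp [hessQuadric_self, Derivation.leibniz, pdz_qz, pdz_qzbar, hab, hqa]
  have e2 : pdz b (hessQuadric l b a a) = X (Sum.inr b) := by
    simp [hessQuadric_self, Derivation.leibniz, pdz_qz, pdz_qzbar, hab.symm, hqb]
  change _ = X (Sum.inl a) * pdz a (hessQuadric l b a a * S) +
    X (Sum.inl b) * pdz b (hessQuadric l b a a * S) +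
    ((0 + 1 : ℕ) : Poly n) * (hessQuadric l b a a * S)
  rw [Derivation.leibniz, Derivation.leibniz, e1, e2]
  refine hR.trans ?_
  push_cast
  simp only [smul_eq_mul]
  linear_combination S * hM

end TwoVariables

end Divisibility

/-! ### Solution of the linearized identities -/
section Multiplier

open MvPolynomial

variable {n : ℕ} {l : Fin n → ℝ} {a b : Fin n} {E : Poly n}

/-- The Hessian of `E` is proportional to that of the quadric on the tangent vectors of the
bracket identities. -/
structure HessianProportional (l : Fin n → ℝ) (a b : Fin n) (E : Poly n) : Prop where
  identity : ∀ j k, j ≠ a → j ≠ b → k ≠ a → k ≠ b →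
    hess l b E j k * hessQuadric l b a a = hessQuadric l b j k * hess l b E a a
  identity_first : ∀ k, k ≠ a → k ≠ b →
    hess l b E a k * hessQuadric l b a a = hessQuadric l b a k * hess l b E a a

lemma HessianProportional.all (h : HessianProportional l a b E) (hE : pconj E = E) {j k : Fin n}
    (hj : j ≠ b) (hk : k ≠ b) :
    hess l b E j k * hessQuadric l b a a = hessQuadric l b j k * hess l b E a a := by
  by_cases hja : j = a
  · subst hja
    by_cases hka : k = j
    · subst hka; ring
    · exact h.identity_first k hka hk
  · by_cases hka : k = a
    · subst hka
      simpa [pconj_hess _ _ _ _ hE, pconj_hessQuadric] using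
        congrArg pconj (h.identity_first j hja hj)
    · exact h.identity j k hja hj hka hk

/-- The quotient of the Hessians of `E` and of the quadric is a polynomial. -/
lemma hessQuadric_dvd_hess (hab : a ≠ b) (hl : ∀ i, 0 ≤ l i) (hl' : ∃ i, l i ≠ 1 / 2)
    (hE : pconj E = E) (h : HessianProportional l a b E) (h' : ResidueIdentity l a b E) :
    hessQuadric l b a a ∣ hess l b E a a := by
  by_cases hc : ∃ c, c ≠ a ∧ c ≠ b
  · obtain ⟨c, hca, hcb⟩ := hc
    have h1 := h.all hE hab hcb
    have e : hessQuadric l b a c = qz l a * qzbar l c := by simp [hessQuadric, Ne.symm hca]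
    rw [e] at h1
    exact dvd_of_dvd_prime_mul (prime_qzbar l c) (not_qzbar_dvd_hessQuadric_of_ne hl hab hca)
      (dvd_of_dvd_prime_mul (prime_qz l a) (not_qz_dvd_hessQuadric l hab)
        ⟨hess l b E a c, by linear_combination -h1⟩)
  · push Not at hc
    by_cases heq : l a = l b
    · by_cases h0 : l a = 0
      · exact h'.dvd_of_coeff_zero hab h0 (heq ▸ h0)
      · refine h'.dvd_of_coeff_eq hab hl heq ?_ h0
        obtain ⟨i, hi⟩ := hl'
        by_cases hia : i = a
        · exact hia ▸ hi
        · rw [heq, ← hc i hia]; exact hi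
    · exact h'.dvd_of_coeff_ne hab hE hl heq

/-- If a family of polynomials `r k` satisfies the symmetry relation `hr` between its tangential
derivatives and is annihilated by one tangential vector field, it is annihilated by all. For the
vector field of index `j` this follows by commuting it with the one of index `a`. -/
lemma tangential_eq_zero (hab : a ≠ b) {r : Fin n → Poly n}
    (hr : ∀ j k, j ≠ b → k ≠ b →
      qzbar l b * tangential l b j (r k) = qzbar l k * tangential l b j (r b))
    (h0 : tangential l b a (r b) = 0) (j k : Fin n) : tangential l b j (r k) = 0 := by
  have hr' : ∀ j k, j ≠ b →
      qzbar l b * tangential l b j (r k) = qzbar l k * tangential l b j (r b) := by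
    intro j k hj
    by_cases hk : k = b
    · subst hk; rfl
    · exact hr j k hj hk
  have ha : ∀ k, tangential l b a (r k) = 0 := fun k =>
    (mul_eq_zero.mp ((hr' a k hab).trans (by rw [h0, mul_zero]))).resolve_left (qzbar_ne_zero l b)
  by_cases hjb : j = b
  · subst hjb; rw [tangential_apply]; ring
  by_cases hja : j = a
  · subst hja; exact ha k
  -- The commutator of the fields of index `a` and `j` is a combination of the two.
  have hcomm : ∀ k, qz l b * tangential l b a (tangential l b j (r k)) =
      -(C (2 * (l b : ℂ)) * qz l a * tangential l b j (r k)) := by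
    intro k
    have h1 := ha k
    have h2 := congrArg (pdz j) h1
    have h3 := congrArg (pdz b) h1
    have e1 := pderiv_comm (Sum.inl j) (Sum.inl a) (r k)
    have e2 := pderiv_comm (Sum.inl b) (Sum.inl a) (r k)
    have e3 := pderiv_comm (Sum.inl b) (Sum.inl j) (r k)
    simp only [tangential_apply, map_sub, Derivation.leibniz, pdz_qz, smul_eq_mul, if_true,
      if_neg hjb, if_neg hja, if_neg hab, if_neg (Ne.symm hjb), if_neg (Ne.symm hja),
      if_neg hab.symm, map_zero, mul_zero, add_zero, e1, e2, e3] at h1 h2 h3 ⊢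
    linear_combination (qz l b) ^ 2 * h2 - qz l b * qz l j * h3 +
      qz l j * C (2 * (l b : ℂ)) * h1
  have hb : tangential l b j (r b) = 0 := by
    have h1 := congrArg (fun f => qz l b * tangential l b a f) (hr' j a hjb)
    have h2 := hr' j a hjb
    simp only [Derivation.leibniz, tangential_qzbar_left hab, tangential_qzbar_right hab,
      smul_eq_mul] at h1
    have h3 : qz l b * (qz l b * tangential l b j (r b) + qz l a * tangential l b j (r a)) = 0 := by
      linear_combination -h1 + qzbar l b * hcomm a - qzbar l a * hcomm b
        - C (2 * (l b : ℂ)) * qz l a * h2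
    have h4 := (mul_eq_zero.mp h3).resolve_left (qz_ne_zero l b)
    refine (mul_eq_zero.mp (?_ : hessQuadric l b a a * _ = 0)).resolve_left
      (hessQuadric_ne_zero l hab)
    rw [hessQuadric_self]
    linear_combination qzbar l b * h4 - qz l a * h2
  exact (mul_eq_zero.mp ((hr' j k hjb).trans (by rw [hb, mul_zero]))).resolve_left
    (qzbar_ne_zero l b)

/-- The polynomial solutions of the linearized non-minimality identities are the real parts of
the `f (z, q)`. -/
theorem exists_plug_of_linearized (hab : a ≠ b) (hl : ∀ i, 0 ≤ l i) (hl' : ∃ i, l i ≠ 1 / 2)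
    (hE : pconj E = E) (h : HessianProportional l a b E) (h' : ResidueIdentity l a b E) :
    ∃ f, E = plug l f + pconj (plug l f) := by
  obtain ⟨κ, hκ⟩ := hessQuadric_dvd_hess hab hl hl' hE h h'
  have hM := hessQuadric_ne_zero l hab
  have hreal : pconj κ = κ := by
    refine mul_left_cancel₀ hM ?_
    rw [← hκ, ← pconj_hess l b a a hE, hκ, map_mul, pconj_hessQuadric]
  have hall : ∀ j k, j ≠ b → k ≠ b → hess l b E j k = κ * hessQuadric l b j k :=
    fun j k hj hk => mul_right_cancel₀ hM (by rw [h.all hE hj hk, hκ]; ring)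
  have hr : ∀ j k, j ≠ b → k ≠ b →
      qzbar l b * tangential l b j (residue l E κ k) =
        qzbar l k * tangential l b j (residue l E κ b) := by
    intro j k hj hk
    have h1 := hall j k hj hk
    simp only [tangential_apply, pdz_residue, if_neg hj, if_neg (Ne.symm hk), if_true]
    simp only [hess, hessQuadric] at h1
    split_ifs at h1 ⊢ <;> linear_combination h1
  have h0 : tangential l b a (residue l E κ b) = 0 := by
    have e : pdzbar b E * hessQuadric l b a a - qzbar l b * hess l b E a a =
        hessQuadric l b a a * residue l E κ b := by rw [hκ, residue]; ring
    rw [ResidueIdentity, e, Derivation.leibniz, smul_eq_mul, smul_eq_mul] at h'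
    refine mul_left_cancel₀ (mul_ne_zero hM hM) ?_
    linear_combination h'
  refine IsMultiplier.exists_plug (κ := κ) hab (fun i j k => ?_) hE hreal
  have hi := tangential_eq_zero hab hr h0 i k
  have hj := tangential_eq_zero hab hr h0 j k
  rw [tangential_apply] at hi hj
  refine mul_left_cancel₀ (qz_ne_zero l b) ?_
  linear_combination qz l j * hi - qz l i * hj

end Multiplier

/-! ### Conjugation and derivatives of power series -/
section SeriesCalculus

open MvPowerSeries

variable {n : ℕ}

lemma coeff_conj (φ : Series n) (d : Fin n ⊕ Fin n →₀ ℕ) :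
    coeff d (conj φ) = starRingEnd ℂ (coeff (d.mapDomain Sum.swap) φ) := by
  have h : d = Finsupp.embDomain (Equiv.sumComm (Fin n) (Fin n)).toEmbedding
      (d.mapDomain Sum.swap) := by
    rw [Finsupp.embDomain_eq_mapDomain]
    change d = (d.mapDomain Sum.swap).mapDomain Sum.swap
    rw [← Finsupp.mapDomain_comp]
    simp
  conv_lhs => rw [h]
  change coeff _ (MvPowerSeries.map (starRingEnd ℂ)
    (rename (Equiv.sumComm (Fin n) (Fin n)).toEmbedding φ)) = _
  rw [coeff_map, coeff_embDomain_rename]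

@[simp] lemma conj_conj (φ : Series n) : conj (conj φ) = φ := by
  ext d
  rw [coeff_conj, coeff_conj, ← Finsupp.mapDomain_comp]
  simp

@[simp] lemma conj_C (c : ℂ) : conj (C c : Series n) = C (starRingEnd ℂ c) := by
  simp [conj]

lemma conj_dz (i : Fin n) (φ : Series n) : conj (dz i φ) = dzbar i (conj φ) := by
  ext d
  have h1 : (d.mapDomain Sum.swap) (Sum.inl i) = d (Sum.inr i) :=
    Finsupp.mapDomain_apply Sum.swap_leftInverse.injective d (Sum.inr i)
  have h2 : (d + Finsupp.single (Sum.inr i) 1).mapDomain Sum.swap =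
      d.mapDomain Sum.swap + Finsupp.single (Sum.inl i) 1 := by
    simp [Finsupp.mapDomain_add, Finsupp.mapDomain_single]
  rw [dz, dzbar, coeff_conj, coeff_pderiv, coeff_pderiv, coeff_conj, h1, h2]
  simp

lemma conj_dzbar (i : Fin n) (φ : Series n) : conj (dzbar i φ) = dz i (conj φ) := by
  rw [← conj_conj (dz i (conj φ)), conj_dz, conj_conj]

lemma conj_coe (P : Poly n) : conj (P : Series n) = (pconj P : Poly n) := by
  ext d
  rw [coeff_conj, MvPolynomial.coeff_coe, MvPolynomial.coeff_coe]
  have h : d = (d.mapDomain Sum.swap).mapDomain Sum.swap := by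
    rw [← Finsupp.mapDomain_comp]; simp
  conv_rhs => rw [h]
  change _ = MvPolynomial.coeff _ (MvPolynomial.map (starRingEnd ℂ)
    (MvPolynomial.rename Sum.swap P))
  rw [MvPolynomial.coeff_map, MvPolynomial.coeff_rename_mapDomain _
    Sum.swap_leftInverse.injective]

lemma dzbar_dz (i k : Fin n) (φ : Series n) : dzbar k (dz i φ) = dz i (dzbar k φ) := by
  ext d
  simp only [dz, dzbar, coeff_pderiv, Finsupp.add_apply, Finsupp.single_apply, reduceCtorEq,
    if_false, add_zero, add_right_comm d]
  ring

lemma dz_add (i : Fin n) (φ ψ : Series n) : dz i (φ + ψ) = dz i φ + dz i ψ := map_add _ _ _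

lemma dz_sub (i : Fin n) (φ ψ : Series n) : dz i (φ - ψ) = dz i φ - dz i ψ := map_sub _ _ _

lemma dz_neg (i : Fin n) (φ : Series n) : dz i (-φ) = -dz i φ := map_neg _ _

lemma dz_mul (i : Fin n) (φ ψ : Series n) : dz i (φ * ψ) = φ * dz i ψ + ψ * dz i φ :=
  Derivation.leibniz _ _ _

lemma dz_C (i : Fin n) (c : ℂ) : dz i (C c) = 0 := pderiv_C

lemma dzbar_sub (i : Fin n) (φ ψ : Series n) : dzbar i (φ - ψ) = dzbar i φ - dzbar i ψ :=
  map_sub _ _ _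

lemma dzbar_mul (i : Fin n) (φ ψ : Series n) :
    dzbar i (φ * ψ) = φ * dzbar i ψ + ψ * dzbar i φ := Derivation.leibniz _ _ _

lemma dzbar_C (i : Fin n) (c : ℂ) : dzbar i (C c) = 0 := pderiv_C

end SeriesCalculus

/-! ### Non-minimality and its invariance -/

section NonMinimality

open MvPowerSeries

variable {n : ℕ}

/-- The complex Hessian of `φ` evaluated on the tangent vectors
`σ_b ∂_j - σ_j ∂_b` and `ρ_bbar ∂_kbar - ρ_kbar ∂_bbar`, where `σ` is the conjugate of `ρ`. -/
def lev (b : Fin n) (ρ φ : Series n) (j k : Fin n) : Series n :=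
  dz b (conj ρ) * dzbar b ρ * dz j (dzbar k φ) - dz j (conj ρ) * dzbar b ρ * dz b (dzbar k φ)
    - dz b (conj ρ) * dzbar k ρ * dz j (dzbar b φ) + dz j (conj ρ) * dzbar k ρ * dz b (dzbar b φ)

/-- The vector field `σ_b ∂_a - σ_a ∂_b`, where `σ` is the conjugate of `ρ`. -/
def tang (a b : Fin n) (ρ φ : Series n) : Series n :=
  dz b (conj ρ) * dz a φ - dz a (conj ρ) * dz b φ

/-- The combination of the Hessians of `ρ` and its conjugate `σ` whose quotient by the Hessian
`lev b ρ ρ a a` is annihilated by `tang a b ρ` when the triple bracket identity holds. -/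
def numer (a b : Fin n) (ρ : Series n) : Series n :=
  dzbar b ρ * lev b ρ (conj ρ) a a - dzbar b (conj ρ) * lev b ρ ρ a a

/-- Non-minimality in terms of `ρ = G + i E` and its conjugate `σ`: the components of the brackets
transverse to the vector fields of type (1,0) and (0,1) are the Hessians of `ρ` and `σ`, and they
are proportional to each other. In this form the condition is invariant under holomorphic
transforms. -/
structure TransverseNonMinimal (a b : Fin n) (ρ : Series n) : Prop where
  bracket : ∀ j k, j ≠ a → j ≠ b → k ≠ a → k ≠ b →
    lev b ρ ρ j k * lev b ρ (conj ρ) a a = lev b ρ ρ a a * lev b ρ (conj ρ) j k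
  bracket_first : ∀ k, k ≠ a → k ≠ b →
    lev b ρ ρ a k * lev b ρ (conj ρ) a a = lev b ρ ρ a a * lev b ρ (conj ρ) a k
  triple : tang a b ρ (numer a b ρ) * lev b ρ ρ a a = numer a b ρ * tang a b ρ (lev b ρ ρ a a)

lemma tang_add (a b : Fin n) (ρ φ ψ : Series n) :
    tang a b ρ (φ + ψ) = tang a b ρ φ + tang a b ρ ψ := by
  simp only [tang, dz_add]; ring

lemma tang_sub (a b : Fin n) (ρ φ ψ : Series n) :
    tang a b ρ (φ - ψ) = tang a b ρ φ - tang a b ρ ψ := by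
  simp only [tang, dz_sub]; ring

lemma tang_neg (a b : Fin n) (ρ φ : Series n) : tang a b ρ (-φ) = -tang a b ρ φ := by
  simp only [tang, dz_neg]; ring

lemma tang_mul (a b : Fin n) (ρ φ ψ : Series n) :
    tang a b ρ (φ * ψ) = φ * tang a b ρ ψ + ψ * tang a b ρ φ := by
  simp only [tang, dz_mul]; ring

section Brackets

variable {a b : Fin n} {G E : Series n}

lemma conj_add_I_mul (hG : IsReal G) (hE : IsReal E) :
    conj (G + C Complex.I * E) = G - C Complex.I * E := by
  rw [map_add, map_mul, conj_C, hG, hE, Complex.conj_I, map_neg]; ring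

lemma cB_eq (hG : IsReal G) (hE : IsReal E) (j : Fin n) :
    cB G E j = dz j (conj (G + C Complex.I * E)) := by
  rw [conj_add_I_mul hG hE, cB, dz_sub, dz_mul, dz_C]; ring

lemma cA_eq (hG : IsReal G) (hE : IsReal E) : cA b G E = dz b (conj (G + C Complex.I * E)) :=
  cB_eq hG hE b

lemma conj_cB_eq (hG : IsReal G) (hE : IsReal E) (j : Fin n) :
    conj (cB G E j) = dzbar j (G + C Complex.I * E) := by
  rw [cB_eq hG hE, conj_dz, conj_conj]

lemma conj_cA_eq (hG : IsReal G) (hE : IsReal E) :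
    conj (cA b G E) = dzbar b (G + C Complex.I * E) := conj_cB_eq hG hE b

lemma cC_eq (hG : IsReal G) (hE : IsReal E) (j : Fin n) :
    cC b G E j = dz b (conj (G + C Complex.I * E)) * dz j (G + C Complex.I * E) -
      dz j (conj (G + C Complex.I * E)) * dz b (G + C Complex.I * E) := by
  rw [conj_add_I_mul hG hE, cC]
  simp only [dz_sub, dz_add, dz_mul, dz_C, map_mul, map_ofNat]
  ring

lemma conj_cC_eq (hG : IsReal G) (hE : IsReal E) (j : Fin n) :
    conj (cC b G E j) =
      dzbar b (G + C Complex.I * E) * dzbar j (conj (G + C Complex.I * E)) -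
        dzbar j (G + C Complex.I * E) * dzbar b (conj (G + C Complex.I * E)) := by
  rw [cC_eq hG hE]
  simp only [map_sub, map_mul, conj_dz, conj_conj]

lemma actL_eq (hG : IsReal G) (hE : IsReal E) (j : Fin n) (φ : Series n) :
    actL b G E j φ = tang j b (G + C Complex.I * E) φ := by
  rw [actL, cA_eq hG hE, cB_eq hG hE, tang]

/-- The (0,1) part of the bracket, applied to `ρ`. -/
lemma bracket_antiholomorphic (hG : IsReal G) (hE : IsReal E) (j k : Fin n) :
    conj (cA b G E) * lam2 b G E j k + conj (cB G E k) * lam1 b G E j k =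
      -lev b (G + C Complex.I * E) (G + C Complex.I * E) j k := by
  simp only [lam1, lam2, actL_eq hG hE, conj_cA_eq hG hE, conj_cB_eq hG hE, lev, tang]
  ring

/-- The bracket applied to `ρ`, corrected by a multiple of `L j`: `ρ_b` times its (1,0) part applied
to the conjugate `σ` of `ρ`, plus `σ_b` times its (0,1) part applied to `ρ`. -/
lemma bracket_total (hG : IsReal G) (hE : IsReal E) (j k : Fin n) :
    cA b G E * lam6 b G E j k - cC b G E j * lam4 b G E j k =
      dz b (G + C Complex.I * E) *
          lev b (G + C Complex.I * E) (conj (G + C Complex.I * E)) j k -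
        dz b (conj (G + C Complex.I * E)) *
          lev b (G + C Complex.I * E) (G + C Complex.I * E) j k := by
  simp only [lam4, lam6, actLbar, conj_cB_eq hG hE, cC_eq hG hE, cA_eq hG hE, conj_dz, conj_conj,
    dzbar_sub, dzbar_mul, dzbar_dz, lev]
  ring

lemma bracket_conj_total (hG : IsReal G) (hE : IsReal E) :
    conj (cA b G E) * lam3 b G E a a - lam1 b G E a a * conj (cC b G E a) =
      numer a b (G + C Complex.I * E) := by
  simp only [lam1, lam3, actL_eq hG hE, conj_cA_eq hG hE, conj_cC_eq hG hE, numer, lev, tang,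
    dz_sub, dz_mul]
  ring

/-- The (0,1) part of the triple bracket applied to `ρ`: the terms in which `L a` differentiates
`conj A` and `conj B` cancel. -/
lemma triple_antiholomorphic (hG : IsReal G) (hE : IsReal E) :
    conj (cA b G E) * Gam2 a b G E + Gam1 a b G E * conj (cB G E a) =
      -tang a b (G + C Complex.I * E)
        (lev b (G + C Complex.I * E) (G + C Complex.I * E) a a) := by
  rw [← tang_neg, ← bracket_antiholomorphic hG hE, tang_add, tang_mul, tang_mul]
  simp only [Gam1, Gam2, lam1, lam2, actL_eq hG hE]
  ring

lemma triple_conj_total (hG : IsReal G) (hE : IsReal E) :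
    conj (cA b G E) * Gam3 a b G E - Gam1 a b G E * conj (cC b G E a) =
      tang a b (G + C Complex.I * E) (numer a b (G + C Complex.I * E)) := by
  rw [← bracket_conj_total hG hE, tang_sub, tang_mul, tang_mul]
  simp only [Gam1, Gam3, lam1, lam3, actL_eq hG hE]
  ring

lemma BracketIdentity.lev_eq (hG : IsReal G) (hE : IsReal E)
    (h0 : dz b (G + C Complex.I * E) ≠ 0) {j k : Fin n} (h : BracketIdentity a b G E j k) :
    lev b (G + C Complex.I * E) (G + C Complex.I * E) j k *
        lev b (G + C Complex.I * E) (conj (G + C Complex.I * E)) a a =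
      lev b (G + C Complex.I * E) (G + C Complex.I * E) a a *
        lev b (G + C Complex.I * E) (conj (G + C Complex.I * E)) j k := by
  rw [BracketIdentity, bracket_antiholomorphic hG hE, bracket_antiholomorphic hG hE,
    bracket_total hG hE, bracket_total hG hE] at h
  refine mul_left_cancel₀ h0 ?_
  linear_combination -h

lemma TripleBracketIdentity.tang_eq (hG : IsReal G) (hE : IsReal E)
    (h : TripleBracketIdentity a b G E) :
    tang a b (G + C Complex.I * E) (numer a b (G + C Complex.I * E)) *
        lev b (G + C Complex.I * E) (G + C Complex.I * E) a a =
      numer a b (G + C Complex.I * E) * tang a b (G + C Complex.I * E)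
        (lev b (G + C Complex.I * E) (G + C Complex.I * E) a a) := by
  rw [TripleBracketIdentity, triple_antiholomorphic hG hE, triple_conj_total hG hE,
    bracket_conj_total hG hE, mul_comm (lam1 b G E a a), bracket_antiholomorphic hG hE] at h
  linear_combination h

lemma FormallyNonMinimal.transverse {hn : 2 ≤ n} (hG : IsReal G) (hE : IsReal E)
    (h : FormallyNonMinimal hn G E) (h0 : dz (lastIdx hn) (G + C Complex.I * E) ≠ 0) :
    TransverseNonMinimal (firstIdx hn) (lastIdx hn) (G + C Complex.I * E) where
  bracket j k h1 h2 h3 h4 := (h.bracket j k h1 h2 h3 h4).lev_eq hG hE h0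
  bracket_first k h1 h2 := (h.bracket_first k h1 h2).lev_eq hG hE h0
  triple := h.triple.tang_eq hG hE

end Brackets

/-- The substitution `h (z, w) ↦ h (z, ρ)` for polynomials `h`. -/
def plugSeries (ρ : Series n) : MvPolynomial (Fin n ⊕ Unit) ℂ →ₐ[ℂ] Series n :=
  MvPolynomial.aeval (Sum.elim z fun _ => ρ)

lemma dz_plugSeries (ρ : Series n) (j : Fin n) (h : MvPolynomial (Fin n ⊕ Unit) ℂ) :
    dz j (plugSeries ρ h) = plugSeries ρ (MvPolynomial.pderiv (Sum.inl j) h) +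
      plugSeries ρ (MvPolynomial.pderiv (Sum.inr ()) h) * dz j ρ := by
  classical
  rw [plugSeries, dz, derivation_aeval_sumElim]
  simp [z, pderiv_X, Pi.single_apply, dz]

lemma dzbar_plugSeries (ρ : Series n) (j : Fin n) (h : MvPolynomial (Fin n ⊕ Unit) ℂ) :
    dzbar j (plugSeries ρ h) = plugSeries ρ (MvPolynomial.pderiv (Sum.inr ()) h) * dzbar j ρ := by
  classical
  rw [plugSeries, dzbar, derivation_aeval_sumElim]
  simp [z, dzbar]

lemma dz_conj_plugSeries (ρ : Series n) (j : Fin n) (h : MvPolynomial (Fin n ⊕ Unit) ℂ) :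
    dz j (conj (plugSeries ρ h)) =
      conj (plugSeries ρ (MvPolynomial.pderiv (Sum.inr ()) h)) * dz j (conj ρ) := by
  rw [← conj_dzbar, dzbar_plugSeries, map_mul, conj_dzbar]

lemma dzbar_conj_plugSeries (ρ : Series n) (j : Fin n) (h : MvPolynomial (Fin n ⊕ Unit) ℂ) :
    dzbar j (conj (plugSeries ρ h)) = conj (plugSeries ρ (MvPolynomial.pderiv (Sum.inl j) h)) +
      conj (plugSeries ρ (MvPolynomial.pderiv (Sum.inr ()) h)) * dzbar j (conj ρ) := by
  rw [← conj_dz, dz_plugSeries, map_add, map_mul, conj_dz]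

lemma tang_conj_plugSeries (a b : Fin n) (ρ : Series n) (h : MvPolynomial (Fin n ⊕ Unit) ℂ) :
    tang a b ρ (conj (plugSeries ρ h)) = 0 := by
  rw [tang, dz_conj_plugSeries, dz_conj_plugSeries]; ring

lemma lev_plugSeries_self (b : Fin n) (ρ : Series n) (h : MvPolynomial (Fin n ⊕ Unit) ℂ)
    (j k : Fin n) : lev b (plugSeries ρ h) (plugSeries ρ h) j k =
      conj (plugSeries ρ (MvPolynomial.pderiv (Sum.inr ()) h)) *
        plugSeries ρ (MvPolynomial.pderiv (Sum.inr ()) h) ^ 2 * lev b ρ ρ j k := by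
  simp only [lev, dz_conj_plugSeries, dzbar_plugSeries, dz_mul]
  ring

lemma lev_plugSeries_conj (b : Fin n) (ρ : Series n) (h : MvPolynomial (Fin n ⊕ Unit) ℂ)
    (j k : Fin n) : lev b (plugSeries ρ h) (conj (plugSeries ρ h)) j k =
      conj (plugSeries ρ (MvPolynomial.pderiv (Sum.inr ()) h)) ^ 2 *
        plugSeries ρ (MvPolynomial.pderiv (Sum.inr ()) h) * lev b ρ (conj ρ) j k := by
  simp only [lev, dz_conj_plugSeries, dzbar_plugSeries, dzbar_conj_plugSeries, dz_mul, dz_add]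
  ring

lemma tang_plugSeries (a b : Fin n) (ρ φ : Series n) (h : MvPolynomial (Fin n ⊕ Unit) ℂ) :
    tang a b (plugSeries ρ h) φ =
      conj (plugSeries ρ (MvPolynomial.pderiv (Sum.inr ()) h)) * tang a b ρ φ := by
  simp only [tang, dz_conj_plugSeries]; ring

lemma numer_plugSeries (a b : Fin n) (ρ : Series n) (h : MvPolynomial (Fin n ⊕ Unit) ℂ) :
    numer a b (plugSeries ρ h) =
      conj (plugSeries ρ (MvPolynomial.pderiv (Sum.inr ()) h)) *
        plugSeries ρ (MvPolynomial.pderiv (Sum.inr ()) h) ^ 2 *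
        (conj (plugSeries ρ (MvPolynomial.pderiv (Sum.inr ()) h)) * numer a b ρ -
          conj (plugSeries ρ (MvPolynomial.pderiv (Sum.inl b) h)) * lev b ρ ρ a a) := by
  simp only [numer, lev_plugSeries_self, lev_plugSeries_conj, dzbar_plugSeries,
    dzbar_conj_plugSeries]
  ring

/-- Non-minimality is invariant under the transforms `w' = h (z, w)`. -/
lemma TransverseNonMinimal.plugSeries {a b : Fin n} {ρ : Series n}
    (H : TransverseNonMinimal a b ρ) (h : MvPolynomial (Fin n ⊕ Unit) ℂ) :
    TransverseNonMinimal a b (plugSeries ρ h) where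
  bracket j k h1 h2 h3 h4 := by
    simp only [lev_plugSeries_self, lev_plugSeries_conj]
    linear_combination (conj (FormalCR.plugSeries ρ (MvPolynomial.pderiv (Sum.inr ()) h)) ^ 3 *
      FormalCR.plugSeries ρ (MvPolynomial.pderiv (Sum.inr ()) h) ^ 3) * H.bracket j k h1 h2 h3 h4
  bracket_first k h1 h2 := by
    simp only [lev_plugSeries_self, lev_plugSeries_conj]
    linear_combination (conj (FormalCR.plugSeries ρ (MvPolynomial.pderiv (Sum.inr ()) h)) ^ 3 *
      FormalCR.plugSeries ρ (MvPolynomial.pderiv (Sum.inr ()) h) ^ 3) * H.bracket_first k h1 h2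
  triple := by
    have H3 := H.triple
    simp only [lev_plugSeries_self, numer_plugSeries, tang_plugSeries, tang_mul, tang_sub,
      tang_conj_plugSeries]
    generalize conj (FormalCR.plugSeries ρ (MvPolynomial.pderiv (Sum.inr ()) h)) = u
    generalize FormalCR.plugSeries ρ (MvPolynomial.pderiv (Sum.inr ()) h) = v
    generalize conj (FormalCR.plugSeries ρ (MvPolynomial.pderiv (Sum.inl b) h)) = g
    linear_combination (u * (u * v ^ 2) ^ 2 * u) * H3

end NonMinimality

/-! ### Leading forms -/
section LeadingForms

open MvPowerSeries

variable {n : ℕ}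

lemma coeff_pconj (P : Poly n) (d : Fin n ⊕ Fin n →₀ ℕ) :
    (pconj P).coeff d = starRingEnd ℂ (P.coeff (d.mapDomain Sum.swap)) := by
  rw [← MvPolynomial.coeff_coe, ← conj_coe, coeff_conj, MvPolynomial.coeff_coe]

lemma nat_le_order_iff {φ : Series n} {m : ℕ} :
    (m : ℕ∞) ≤ φ.order ↔ ∀ d : Fin n ⊕ Fin n →₀ ℕ, d.degree < m → coeff d φ = 0 :=
  ⟨fun h _ hd => coeff_of_lt_order ((Nat.cast_lt.mpr hd).trans_le h), fun h => nat_le_order h⟩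

lemma le_order_sub {φ ψ : Series n} {m : ℕ∞} (hφ : m ≤ φ.order) (hψ : m ≤ ψ.order) :
    m ≤ (φ - ψ).order := by
  rw [sub_eq_add_neg]
  exact (le_min hφ (by rwa [order_neg])).trans min_order_le_add

lemma le_order_add {φ ψ : Series n} {m : ℕ∞} (hφ : m ≤ φ.order) (hψ : m ≤ ψ.order) :
    m ≤ (φ + ψ).order := (le_min hφ hψ).trans min_order_le_add

lemma le_order_pderiv {φ : Series n} {m : ℕ} (i : Fin n ⊕ Fin n)
    (h : ((m + 1 : ℕ) : ℕ∞) ≤ φ.order) : (m : ℕ∞) ≤ (pderiv ℂ i φ).order := by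
  rw [nat_le_order_iff] at h ⊢
  intro d hd
  rw [coeff_pderiv, h _ (by simpa using hd), zero_mul]

lemma le_order_conj {φ : Series n} {m : ℕ} (h : (m : ℕ∞) ≤ φ.order) :
    (m : ℕ∞) ≤ (conj φ).order := by
  rw [nat_le_order_iff] at h ⊢
  intro d hd
  rw [coeff_conj, h _ (by rwa [Finsupp.degree_mapDomain]), map_zero]

lemma le_order_coe {P : Poly n} {m : ℕ} (h : P.IsHomogeneous m) :
    (m : ℕ∞) ≤ (P : Series n).order := by
  rw [nat_le_order_iff]
  intro d hd
  rw [MvPolynomial.coeff_coe]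
  exact h.coeff_eq_zero hd.ne

/-- The polynomial `P` is the homogeneous part of degree `m` of `φ`, and `φ` has no terms of lower
degree. The polynomial `P` may vanish. -/
structure IsLeading (m : ℕ) (φ : Series n) (P : Poly n) : Prop where
  isHomogeneous : P.IsHomogeneous m
  le_order_sub_coe : ((m + 1 : ℕ) : ℕ∞) ≤ (φ - P).order

namespace IsLeading

variable {m k : ℕ} {φ ψ : Series n} {P Q : Poly n}

lemma le_order (h : IsLeading m φ P) : (m : ℕ∞) ≤ φ.order := by
  rw [show φ = (φ - P) + P by ring]
  exact le_order_add ((Nat.cast_le.mpr m.le_succ).trans h.2) (le_order_coe h.1)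

lemma coe (h : P.IsHomogeneous m) : IsLeading m (P : Series n) P := ⟨h, by simp⟩

lemma add (h : IsLeading m φ P) (h' : IsLeading m ψ Q) : IsLeading m (φ + ψ) (P + Q) := by
  refine ⟨h.1.add h'.1, ?_⟩
  rw [MvPolynomial.coe_add, add_sub_add_comm]
  exact le_order_add h.2 h'.2

lemma sub (h : IsLeading m φ P) (h' : IsLeading m ψ Q) : IsLeading m (φ - ψ) (P - Q) := by
  refine ⟨h.1.sub h'.1, ?_⟩
  have : ((P - Q : Poly n) : Series n) = P - Q :=
    map_sub MvPolynomial.coeToMvPowerSeries.ringHom P Q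
  rw [this, sub_sub_sub_comm]
  exact le_order_sub h.2 h'.2

lemma mul (h : IsLeading m φ P) (h' : IsLeading k ψ Q) : IsLeading (m + k) (φ * ψ) (P * Q) := by
  refine ⟨h.1.mul h'.1, ?_⟩
  rw [MvPolynomial.coe_mul, show φ * ψ - P * Q = (φ - P) * ψ + P * (ψ - Q) by ring]
  refine le_order_add (le_trans ?_ le_order_mul) (le_trans ?_ le_order_mul)
  · refine le_trans ?_ (add_le_add h.2 h'.le_order)
    norm_cast; omega
  · refine le_trans ?_ (add_le_add (le_order_coe h.1) h'.2)
    norm_cast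

lemma dz (h : IsLeading (m + 1) φ P) (i : Fin n) : IsLeading m (dz i φ) (pdz i P) := by
  refine ⟨by simpa using h.1.pderiv (i := Sum.inl i), ?_⟩
  rw [← pderiv_coe, FormalCR.dz, ← map_sub]
  exact le_order_pderiv _ h.2

lemma dzbar (h : IsLeading (m + 1) φ P) (i : Fin n) : IsLeading m (dzbar i φ) (pdzbar i P) := by
  refine ⟨by simpa using h.1.pderiv (i := Sum.inr i), ?_⟩
  rw [← pderiv_coe, FormalCR.dzbar, ← map_sub]
  exact le_order_pderiv _ h.2

lemma conj (h : IsLeading m φ P) : IsLeading m (conj φ) (pconj P) := by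
  refine ⟨fun d hd => ?_, ?_⟩
  · rw [coeff_pconj] at hd
    have h1 := h.1 ((map_ne_zero (starRingEnd ℂ)).mp hd)
    have e : ∀ x : Fin n ⊕ Fin n →₀ ℕ, Finsupp.weight 1 x = x.degree := fun x => by
      rw [Finsupp.degree_eq_weight_one]; rfl
    rw [e] at h1 ⊢
    rwa [Finsupp.degree_mapDomain] at h1
  · rw [← conj_coe, ← map_sub]
    exact le_order_conj h.2

lemma unique (h : IsLeading m φ P) (h' : IsLeading m φ Q) : P = Q := by
  have h0 := h.sub h'
  have h1 := h0.2
  ext d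
  by_cases hd : d.degree = m
  · rw [nat_le_order_iff] at h1
    have h2 := h1 d (by omega)
    rw [sub_self, zero_sub, map_neg, neg_eq_zero, MvPolynomial.coeff_coe,
      MvPolynomial.coeff_sub] at h2
    exact sub_eq_zero.mp h2
  · rw [h.1.coeff_eq_zero hd, h'.1.coeff_eq_zero hd]

lemma exists_of_le_order (h : (m : ℕ∞) ≤ φ.order) : ∃ P, IsLeading m φ P := by
  refine ⟨MvPolynomial.homogeneousComponent m (truncTotal (m + 1) φ),
    MvPolynomial.homogeneousComponent_isHomogeneous _ _, ?_⟩
  rw [nat_le_order_iff] at h ⊢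
  intro d hd
  rw [map_sub, MvPolynomial.coeff_coe, MvPolynomial.coeff_homogeneousComponent]
  split_ifs with h1
  · rw [coeff_truncTotal _ hd, sub_self]
  · rw [h d (by omega), sub_zero]

end IsLeading

variable {l : Fin n → ℝ} {ρ φ : Series n} {P : Poly n} {m : ℕ}

lemma IsLeading.dz_conj_quadric (hρ : IsLeading 2 ρ (quadricPoly l)) (j : Fin n) :
    IsLeading 1 (FormalCR.dz j (FormalCR.conj ρ)) (qz l j) := by
  have h := hρ.conj.dz j
  rwa [pconj_quadricPoly, pdz_quadricPoly] at h

lemma IsLeading.dzbar_quadric (hρ : IsLeading 2 ρ (quadricPoly l)) (j : Fin n) :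
    IsLeading 1 (FormalCR.dzbar j ρ) (qzbar l j) := by
  have h := hρ.dzbar j
  rwa [pdzbar_quadricPoly] at h

lemma IsLeading.lev (hρ : IsLeading 2 ρ (quadricPoly l)) (h : IsLeading (m + 2) φ P)
    (b j k : Fin n) : IsLeading (m + 2) (lev b ρ φ j k) (hess l b P j k) := by
  have key : ∀ i i' s r, IsLeading (m + 2) (FormalCR.dz i (FormalCR.conj ρ) *
      FormalCR.dzbar i' ρ * FormalCR.dz s (FormalCR.dzbar r φ))
      (qz l i * qzbar l i' * pdz s (pdzbar r P)) := by
    intro i i' s r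
    rw [add_comm m 2]
    exact ((hρ.dz_conj_quadric i).mul (hρ.dzbar_quadric i')).mul ((h.dzbar r).dz s)
  exact (((key _ _ _ _).sub (key _ _ _ _)).sub (key _ _ _ _)).add (key _ _ _ _)

lemma hess_quadricPoly {b j k : Fin n} (hj : j ≠ b) (hk : k ≠ b) :
    hess l b (quadricPoly l) j k = hessQuadric l b j k := by
  simp only [hess, hessQuadric, pdzbar_quadricPoly, pdz_qzbar, if_neg hj, if_neg (Ne.symm hk),
    if_true]
  split_ifs <;> ring

lemma IsLeading.tang (hρ : IsLeading 2 ρ (quadricPoly l)) (h : IsLeading (m + 1) φ P)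
    (a b : Fin n) : IsLeading (m + 1) (tang a b ρ φ) (tangential l b a P) := by
  rw [tangential_apply, add_comm m 1]
  exact ((hρ.dz_conj_quadric b).mul (h.dz a)).sub ((hρ.dz_conj_quadric a).mul (h.dz b))

lemma two_I_mul_imPart (ρ : Series n) : C (2 * Complex.I) * imPart ρ = ρ - conj ρ := by
  rw [imPart, ← mul_assoc, ← map_mul, mul_one_div_cancel (by simp), map_one, one_mul]

lemma conj_imPart (ρ : Series n) : conj (imPart ρ) = imPart ρ := by
  rw [imPart, map_mul, map_sub, conj_C, conj_conj]
  have : starRingEnd ℂ (1 / (2 * Complex.I)) = -(1 / (2 * Complex.I)) := by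
    simp [map_ofNat (starRingEnd ℂ) 2]
  rw [this, map_neg]
  ring

lemma lev_conj (b : Fin n) (ρ : Series n) (j k : Fin n) :
    lev b ρ (conj ρ) j k = lev b ρ ρ j k - C (2 * Complex.I) * lev b ρ (imPart ρ) j k := by
  have h : conj ρ = ρ - C (2 * Complex.I) * imPart ρ := by rw [two_I_mul_imPart]; ring
  have h1 : ∀ i r, dz i (dzbar r (conj ρ)) =
      dz i (dzbar r ρ) - C (2 * Complex.I) * dz i (dzbar r (imPart ρ)) := by
    intro i r
    rw [h]
    simp only [dzbar_sub, dzbar_mul, dzbar_C, dz_sub, dz_mul, dz_C, mul_zero, add_zero]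
  simp only [lev, h1]
  ring

lemma numer_eq (a b : Fin n) (ρ : Series n) :
    numer a b ρ = C (2 * Complex.I) *
      (dzbar b (imPart ρ) * lev b ρ ρ a a - dzbar b ρ * lev b ρ (imPart ρ) a a) := by
  have h : conj ρ = ρ - C (2 * Complex.I) * imPart ρ := by rw [two_I_mul_imPart]; ring
  have h1 : dzbar b (conj ρ) = dzbar b ρ - C (2 * Complex.I) * dzbar b (imPart ρ) := by
    rw [h]
    simp only [dzbar_sub, dzbar_mul, dzbar_C, mul_zero, add_zero]
  rw [numer, lev_conj, h1]
  ring

lemma C_two_I_ne_zero : (C (2 * Complex.I) : Series n) ≠ 0 := fun h => by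
  have := congrArg (coeff 0) h
  simp at this

/-- As `σ = ρ - 2 i Im ρ`, the bracket identity involves `σ` only through `Im ρ`. -/
lemma lev_imPart_mul_eq {b : Fin n} {ρ : Series n} {j k a : Fin n}
    (h : lev b ρ ρ j k * lev b ρ (conj ρ) a a = lev b ρ ρ a a * lev b ρ (conj ρ) j k) :
    lev b ρ (imPart ρ) j k * lev b ρ ρ a a = lev b ρ ρ j k * lev b ρ (imPart ρ) a a := by
  rw [lev_conj, lev_conj] at h
  refine mul_left_cancel₀ C_two_I_ne_zero ?_
  linear_combination h

/-- The leading form of the imaginary part satisfies the linearized non-minimality identities. -/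
theorem TransverseNonMinimal.linearized {a b : Fin n} (hab : a ≠ b)
    (H : TransverseNonMinimal a b ρ) (hρ : IsLeading 2 ρ (quadricPoly l))
    (hE : IsLeading (m + 2) (imPart ρ) P) :
    HessianProportional l a b P ∧ ResidueIdentity l a b P := by
  have hb : ∀ {j k}, j ≠ b → k ≠ b →
      lev b ρ ρ j k * lev b ρ (conj ρ) a a = lev b ρ ρ a a * lev b ρ (conj ρ) j k →
      hess l b P j k * hessQuadric l b a a = hessQuadric l b j k * hess l b P a a := by
    intro j k hj hk h
    have h1 := (hρ.lev hE b j k).mul (hρ.lev (m := 0) hρ b a a)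
    have h2 := (hρ.lev (m := 0) hρ b j k).mul (hρ.lev hE b a a)
    rw [lev_imPart_mul_eq h, add_comm] at h1
    have h3 := h1.unique h2
    rwa [hess_quadricPoly hab hab, hess_quadricPoly hj hk] at h3
  refine ⟨⟨fun j k _ hj hka hk => hb hj hk (H.bracket j k ‹_› hj hka hk),
    fun k hka hk => hb hab hk (H.bracket_first k hka hk)⟩, ?_⟩
  have h3 := H.triple
  rw [numer_eq, tang_mul] at h3
  have h4 : tang a b ρ (C (2 * Complex.I)) = 0 := by
    simp only [tang, dz_C, mul_zero, sub_zero]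
  have h5 := mul_left_cancel₀ C_two_I_ne_zero (b := tang a b ρ
    (dzbar b (imPart ρ) * lev b ρ ρ a a - dzbar b ρ * lev b ρ (imPart ρ) a a) * lev b ρ ρ a a)
    (c := (dzbar b (imPart ρ) * lev b ρ ρ a a - dzbar b ρ * lev b ρ (imPart ρ) a a) *
      tang a b ρ (lev b ρ ρ a a)) (by rw [h4] at h3; linear_combination h3)
  have hq := hρ.lev (m := 0) hρ b a a
  rw [hess_quadricPoly hab hab] at hq
  have hy : IsLeading (m + 2 + 1)
      (dzbar b (imPart ρ) * lev b ρ ρ a a - dzbar b ρ * lev b ρ (imPart ρ) a a)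
      (pdzbar b P * hessQuadric l b a a - qzbar l b * hess l b P a a) := by
    have h6 := (hE.dzbar b).mul hq
    have h7 := (hρ.dzbar_quadric b).mul (hρ.lev hE b a a)
    rw [show m + 1 + (0 + 2) = m + 2 + 1 by ring] at h6
    rw [show 1 + (m + 2) = m + 2 + 1 by ring] at h7
    exact h6.sub h7
  have h8 := (hρ.tang hy a b).mul hq
  have h9 := hy.mul (hρ.tang (m := 1) hq a b)
  rw [h5] at h8
  exact h8.unique h9

end LeadingForms

/-! ### Improving the transform -/
section Transforms

open MvPowerSeries

variable {n : ℕ}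

lemma isConvergent_coe {σ : Type*} (f : MvPolynomial σ ℂ) :
    IsConvergent (f : MvPowerSeries σ ℂ) := by
  refine ⟨1, one_pos, summable_of_ne_finset_zero (s := f.support) fun d hd => ?_⟩
  rw [MvPolynomial.coeff_coe, MvPolynomial.notMem_support_iff.mp hd]
  simp

/-- Substituting series of weighted order at least `w i` for the indeterminates does not decrease
the weighted order. -/
lemma le_weightedOrder_aeval {σ τ : Type*} {w : σ → ℕ} {v : τ → ℕ} {g : σ → MvPowerSeries τ ℂ}
    (hg : ∀ i, (w i : ℕ∞) ≤ (g i).weightedOrder v) {f : MvPolynomial σ ℂ} {m : ℕ}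
    (hf : (m : ℕ∞) ≤ (f : MvPowerSeries σ ℂ).weightedOrder w) :
    (m : ℕ∞) ≤ (MvPolynomial.aeval g f).weightedOrder v := by
  refine le_weightedOrder _ fun x hx => ?_
  rw [MvPolynomial.aeval_def, MvPolynomial.eval₂_eq, map_sum]
  refine Finset.sum_eq_zero fun d hd => coeff_eq_zero_of_lt_weightedOrder v (hx.trans_le ?_)
  have h1 : (m : ℕ∞) ≤ Finsupp.weight w d :=
    hf.trans (weightedOrder_le w (by simpa using hd))
  refine h1.trans ?_
  rw [Finsupp.weight_apply, Finsupp.sum]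
  push_cast
  refine le_trans ?_ ((le_weightedOrder_prod v _ _).trans
    (le_trans le_add_self (le_weightedOrder_mul v)))
  refine Finset.sum_le_sum fun i _ => le_trans ?_ (le_weightedOrder_pow v _)
  simpa using mul_le_mul_right (hg i) _

namespace IsLeading

lemma pow {m : ℕ} {φ : Series n} {P : Poly n} (h : IsLeading m φ P) (k : ℕ) :
    IsLeading (k * m) (φ ^ k) (P ^ k) := by
  induction k with
  | zero => simpa using coe (MvPolynomial.isHomogeneous_one (Fin n ⊕ Fin n) ℂ)
  | succ k ih => rw [pow_succ, pow_succ, add_one_mul]; exact ih.mul h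

lemma prod {ι : Type*} (s : Finset ι) {m : ι → ℕ} {φ : ι → Series n} {P : ι → Poly n}
    (h : ∀ i ∈ s, IsLeading (m i) (φ i) (P i)) :
    IsLeading (∑ i ∈ s, m i) (∏ i ∈ s, φ i) (∏ i ∈ s, P i) := by
  classical
  induction s using Finset.induction_on with
  | empty => simpa using coe (MvPolynomial.isHomogeneous_one (Fin n ⊕ Fin n) ℂ)
  | insert i s hi ih =>
    rw [Finset.sum_insert hi, Finset.prod_insert hi, Finset.prod_insert hi]
    exact (h i (Finset.mem_insert_self _ _)).mul
      (ih fun j hj => h j (Finset.mem_insert_of_mem hj))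

lemma sum {ι : Type*} (s : Finset ι) {m : ℕ} {φ : ι → Series n} {P : ι → Poly n}
    (h : ∀ i ∈ s, IsLeading m (φ i) (P i)) :
    IsLeading m (∑ i ∈ s, φ i) (∑ i ∈ s, P i) := by
  classical
  induction s using Finset.induction_on with
  | empty => simpa using coe (MvPolynomial.isHomogeneous_zero (Fin n ⊕ Fin n) ℂ m)
  | insert i s hi ih =>
    rw [Finset.sum_insert hi, Finset.sum_insert hi]
    exact (h i (Finset.mem_insert_self _ _)).add
      (ih fun j hj => h j (Finset.mem_insert_of_mem hj))

end IsLeading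

/-- Substituting `ρ` for `w` in a weighted homogeneous polynomial has the leading form obtained by
substituting the quadric. -/
lemma isLeading_plugSeries {l : Fin n → ℝ} {ρ : Series n} (hρ : IsLeading 2 ρ (quadricPoly l))
    {f : MvPolynomial (Fin n ⊕ Unit) ℂ} {m : ℕ} (hf : f.IsWeightedHomogeneous (weight n) m) :
    IsLeading m (plugSeries ρ f) (plug l f) := by
  rw [plugSeries, plug, MvPolynomial.aeval_def, MvPolynomial.aeval_def, MvPolynomial.eval₂_eq,
    MvPolynomial.eval₂_eq]
  refine IsLeading.sum _ fun d hd => ?_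
  have h1 : ∑ i ∈ d.support, d i * weight n i = m := by
    rw [← hf (MvPolynomial.mem_support_iff.mp hd), Finsupp.weight_apply]
    rfl
  rw [← h1, ← zero_add (∑ i ∈ d.support, d i * weight n i)]
  refine IsLeading.mul ?_ (IsLeading.prod _ fun i _ => IsLeading.pow ?_ _)
  · have h2 := IsLeading.coe (n := n) (MvPolynomial.isHomogeneous_C (Fin n ⊕ Fin n)
      (MvPolynomial.coeff d f))
    rwa [MvPolynomial.coe_C] at h2
  · rcases i with i | i
    · have h2 := IsLeading.coe (n := n) (MvPolynomial.isHomogeneous_X ℂ (Sum.inl i))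
      rwa [MvPolynomial.coe_X] at h2
    · exact hρ

lemma isHomogeneous_quadricPoly (l : Fin n → ℝ) : (quadricPoly l).IsHomogeneous 2 := by
  refine MvPolynomial.IsHomogeneous.sum _ _ _ fun i _ => ?_
  exact ((MvPolynomial.isHomogeneous_X ℂ _).mul (MvPolynomial.isHomogeneous_X ℂ _)).add
    (((MvPolynomial.isHomogeneous_X_pow _ 2).add (MvPolynomial.isHomogeneous_X_pow _ 2)).C_mul _)

lemma isHomogeneous_plug (l : Fin n → ℝ) {f : MvPolynomial (Fin n ⊕ Unit) ℂ} {m : ℕ}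
    (hf : f.IsWeightedHomogeneous (weight n) m) : (plug l f).IsHomogeneous m :=
  (isLeading_plugSeries (IsLeading.coe (isHomogeneous_quadricPoly l)) hf).1

lemma homogeneousComponent_plug (l : Fin n → ℝ) (f : MvPolynomial (Fin n ⊕ Unit) ℂ) (m : ℕ) :
    MvPolynomial.homogeneousComponent m (plug l f) =
      plug l (MvPolynomial.weightedHomogeneousComponent (weight n) m f) := by
  induction f using MvPolynomial.induction_on' with
  | monomial d c =>
    have h := MvPolynomial.isWeightedHomogeneous_monomial (weight n) d c rfl
    rw [MvPolynomial.homogeneousComponent_of_mem (isHomogeneous_plug l h),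
      MvPolynomial.weightedHomogeneousComponent_of_mem h]
    split_ifs <;> simp
  | add p q hp hq => simp only [map_add, hp, hq]

lemma homogeneousComponent_pconj (P : Poly n) (m : ℕ) :
    MvPolynomial.homogeneousComponent m (pconj P) =
      pconj (MvPolynomial.homogeneousComponent m P) := by
  ext d
  rw [MvPolynomial.coeff_homogeneousComponent, coeff_pconj, coeff_pconj,
    MvPolynomial.coeff_homogeneousComponent, Finsupp.degree_mapDomain]
  split_ifs <;> simp

/-- If the real part of `f (z, q)` is homogeneous, `f` can be taken weighted homogeneous. -/
lemma exists_isWeightedHomogeneous {l : Fin n → ℝ} {P : Poly n} {m : ℕ} (hP : P.IsHomogeneous m)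
    (h : ∃ f, P = plug l f + pconj (plug l f)) :
    ∃ f, f.IsWeightedHomogeneous (weight n) m ∧ P = plug l f + pconj (plug l f) := by
  obtain ⟨f, hf⟩ := h
  refine ⟨MvPolynomial.weightedHomogeneousComponent (weight n) m f,
    MvPolynomial.weightedHomogeneousComponent_isWeightedHomogeneous _ _, ?_⟩
  rw [← homogeneousComponent_plug, ← homogeneousComponent_pconj, ← map_add, ← hf,
    MvPolynomial.homogeneousComponent_eq_self hP]

lemma transformed_coe (h : MvPolynomial (Fin n ⊕ Unit) ℂ) (ρ : Series n) :
    transformed (h : AmbientSeries n) ρ = plugSeries ρ h := by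
  rw [transformed, subst_coe, plugSeries]

lemma coe_quadricPoly (l : Fin n → ℝ) : (quadricPoly l : Series n) = quadric l := by
  rw [← MvPolynomial.coeToMvPowerSeries.ringHom_apply, quadricPoly, quadric, map_sum]
  refine Finset.sum_congr rfl fun i _ => ?_
  simp [z, zbar]

lemma coe_aeval {σ τ : Type*} (g : σ → MvPolynomial τ ℂ) (f : MvPolynomial σ ℂ) :
    ((MvPolynomial.aeval g f : MvPolynomial τ ℂ) : MvPowerSeries τ ℂ) =
      MvPolynomial.aeval (fun i => (g i : MvPowerSeries τ ℂ)) f := by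
  induction f using MvPolynomial.induction_on with
  | C a =>
    simp only [MvPolynomial.algHom_C, MvPolynomial.algebraMap_eq, MvPolynomial.coe_C]
    rfl
  | add p q hp hq => simp only [map_add, MvPolynomial.coe_add, hp, hq]
  | mul_X p i hp => simp only [map_mul, MvPolynomial.coe_mul, MvPolynomial.aeval_X, hp]

lemma weightedOrder_X {σ : Type*} (w : σ → ℕ) (i : σ) :
    (X i : MvPowerSeries σ ℂ).weightedOrder w = w i := by
  rw [X, weightedOrder_monomial_of_ne_zero w one_ne_zero]
  simp [Finsupp.weight_apply]

/-- Subtracting from a special transform `h` a multiple of `f (z, h)`, with `f` of weight at least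
3, gives a special transform. -/
lemma IsSpecialTransform.sub_aeval {h : MvPolynomial (Fin n ⊕ Unit) ℂ}
    (hh : IsSpecialTransform (h : AmbientSeries n)) (c : ℂ) {f : MvPolynomial (Fin n ⊕ Unit) ℂ}
    {m : ℕ} (hm : 3 ≤ m) (hf : f.IsWeightedHomogeneous (weight n) m) :
    IsSpecialTransform ((h - MvPolynomial.C c * MvPolynomial.aeval
      (Sum.elim (fun i => MvPolynomial.X (Sum.inl i)) fun _ => h) f :
        MvPolynomial (Fin n ⊕ Unit) ℂ) : AmbientSeries n) := by
  refine ⟨isConvergent_coe _, ?_⟩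
  have hw : ∀ i, (weight n i : ℕ∞) ≤ ((Sum.elim (fun i => MvPolynomial.X (Sum.inl i)) (fun _ => h) i
      : MvPolynomial (Fin n ⊕ Unit) ℂ) : AmbientSeries n).weightedOrder (weight n) := by
    rintro (i | i)
    · rw [Sum.elim_inl, MvPolynomial.coe_X, weightedOrder_X]
    · rw [Sum.elim_inr, ← sub_add_cancel (h : AmbientSeries n) (X (Sum.inr ()))]
      refine (le_min (le_trans ?_ hh.special) ?_).trans (min_weightedOrder_le_add _)
      · simp only [weight, Sum.elim_inr]; norm_num
      · rw [weightedOrder_X]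
  have h1 : (m : ℕ∞) ≤ (f : AmbientSeries n).weightedOrder (weight n) := by
    refine nat_le_weightedOrder _ fun d hd => ?_
    rw [MvPolynomial.coeff_coe]
    exact hf.coeff_eq_zero d hd.ne
  have h2 := le_weightedOrder_aeval hw h1
  rw [← coe_aeval] at h2
  set F := MvPolynomial.aeval (Sum.elim (fun i => MvPolynomial.X (Sum.inl i)) fun _ => h) f
  have e : ((h - MvPolynomial.C c * F : MvPolynomial (Fin n ⊕ Unit) ℂ) : AmbientSeries n) -
      X (Sum.inr ()) =
        ((h : AmbientSeries n) - X (Sum.inr ())) + -(C c * (F : AmbientSeries n)) := by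
    rw [← MvPolynomial.coe_C, ← MvPolynomial.coe_mul, ← sub_eq_add_neg, sub_right_comm]
    congr 1
  rw [e]
  refine (le_min hh.special ?_).trans (min_weightedOrder_le_add _)
  rw [weightedOrder_neg]
  exact le_trans (Nat.cast_le.mpr hm) (h2.trans (le_trans le_add_self (le_weightedOrder_mul _)))

lemma weight_le_order {l : Fin n → ℝ} {ρ : Series n} (hρ : IsLeading 2 ρ (quadricPoly l))
    (i : Fin n ⊕ Unit) : (weight n i : ℕ∞) ≤
      (Sum.elim z (fun _ => ρ) i : Series n).weightedOrder fun _ => 1 := by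
  rcases i with i | i
  · have h := IsLeading.coe (n := n) (MvPolynomial.isHomogeneous_X ℂ (Sum.inl i))
    rw [MvPolynomial.coe_X] at h
    exact h.le_order
  · exact hρ.le_order

/-- A special transform preserves the quadric part of the defining equation. -/
lemma IsLeading.plugSeries_special {l : Fin n → ℝ} {ρ : Series n}
    (hρ : IsLeading 2 ρ (quadricPoly l)) {h : MvPolynomial (Fin n ⊕ Unit) ℂ}
    (hh : IsSpecialTransform (h : AmbientSeries n)) :
    IsLeading 2 (plugSeries ρ h) (quadricPoly l) := by
  refine ⟨isHomogeneous_quadricPoly l, ?_⟩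
  have e : ((h - MvPolynomial.X (Sum.inr ()) : MvPolynomial (Fin n ⊕ Unit) ℂ) : AmbientSeries n) =
      (h : AmbientSeries n) - X (Sum.inr ()) := by
    rw [← MvPolynomial.coe_X]
    exact map_sub MvPolynomial.coeToMvPowerSeries.ringHom _ _
  have h1 : ((3 : ℕ) : ℕ∞) ≤ (plugSeries ρ (h - MvPolynomial.X (Sum.inr ()))).order :=
    le_weightedOrder_aeval (weight_le_order hρ) (by rw [e]; exact hh.special)
  have h2 : plugSeries ρ h - (quadricPoly l : Series n) =
      plugSeries ρ (h - MvPolynomial.X (Sum.inr ())) + (ρ - (quadricPoly l : Series n)) := by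
    rw [map_sub]
    simp [plugSeries]
  rw [h2]
  exact le_order_add h1 hρ.2

/-- A special transform that makes the imaginary part of `ρ` vanish to order `m` can be improved
to one that makes it vanish to order `m + 1`. -/
lemma exists_special_succ (hn : 2 ≤ n) {l : Fin n → ℝ} (hl : ∀ i, 0 ≤ l i)
    (hl' : ∃ i, l i ≠ 1 / 2) {ρ : Series n} (hρ : IsLeading 2 ρ (quadricPoly l))
    (H : TransverseNonMinimal (firstIdx hn) (lastIdx hn) ρ) {m : ℕ} (hm : 3 ≤ m)
    {h : MvPolynomial (Fin n ⊕ Unit) ℂ} (hh : IsSpecialTransform (h : AmbientSeries n))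
    (hE : (m : ℕ∞) ≤ (imPart (plugSeries ρ h)).order) :
    ∃ h' : MvPolynomial (Fin n ⊕ Unit) ℂ, IsSpecialTransform (h' : AmbientSeries n) ∧
      ((m + 1 : ℕ) : ℕ∞) ≤ (imPart (plugSeries ρ h')).order := by
  have hab : firstIdx hn ≠ lastIdx hn := by
    simp only [firstIdx, lastIdx, ne_eq, Fin.mk.injEq]; omega
  obtain ⟨m, rfl⟩ : ∃ k, m = k + 2 := ⟨m - 2, by omega⟩
  have hρ' := hρ.plugSeries_special hh
  obtain ⟨P, hP⟩ := IsLeading.exists_of_le_order hE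
  have hPreal : pconj P = P := by
    have h1 := hP.conj
    rw [conj_imPart] at h1
    exact h1.unique hP
  obtain ⟨hprop, hres⟩ := (H.plugSeries h).linearized hab hρ' hP
  obtain ⟨f, hf, hPf⟩ := exists_isWeightedHomogeneous hP.1
    (exists_plug_of_linearized hab hl hl' hPreal hprop hres)
  set F : MvPolynomial (Fin n ⊕ Unit) ℂ := MvPolynomial.aeval
    (Sum.elim (fun i => MvPolynomial.X (Sum.inl i)) fun _ => h) f with hF
  have hpF : plugSeries ρ F = plugSeries (plugSeries ρ h) f := by
    have h1 : (plugSeries ρ).comp (MvPolynomial.aeval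
        (Sum.elim (fun i => MvPolynomial.X (Sum.inl i)) fun _ => h)) =
        plugSeries (plugSeries ρ h) :=
      MvPolynomial.algHom_ext fun i => by rcases i with i | i <;> simp [plugSeries]
    exact AlgHom.congr_fun h1 f
  refine ⟨h - MvPolynomial.C (2 * Complex.I) * F, hh.sub_aeval _ hm hf, ?_⟩
  · have h1 : imPart (plugSeries ρ (h - MvPolynomial.C (2 * Complex.I) * F)) =
        imPart (plugSeries ρ h) -
          (plugSeries (plugSeries ρ h) f + conj (plugSeries (plugSeries ρ h) f)) := by
      refine mul_left_cancel₀ C_two_I_ne_zero ?_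
      have hC : plugSeries ρ (MvPolynomial.C (2 * Complex.I)) = C (2 * Complex.I) := by
        rw [plugSeries, MvPolynomial.algHom_C]; rfl
      rw [mul_sub, two_I_mul_imPart, two_I_mul_imPart, map_sub, map_mul (plugSeries ρ), hpF, hC,
        map_sub, map_mul conj, conj_C]
      have : starRingEnd ℂ (2 * Complex.I) = -(2 * Complex.I) := by
        simp [map_ofNat (starRingEnd ℂ) 2]
      rw [this, map_neg]
      ring
    have h2 := isLeading_plugSeries hρ' hf
    have h3 := hP.sub (h2.add h2.conj)
    rw [← h1, ← hPf, sub_self] at h3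
    simpa using h3.2

end Transforms

end FormalCR

theorem theorem3p3 (n : ℕ) (hn : 2 ≤ n) (l : Fin n → ℝ) (hl : ∀ i, 0 ≤ l i)
    (hl' : ∃ i, l i ≠ 1 / 2) (p E : FormalCR.Series n)
    (hp : FormalCR.IsReal p) (hE : FormalCR.IsReal E)
    (hp3 : 3 ≤ p.order) (hE3 : 3 ≤ E.order)
    (hM : FormalCR.FormallyNonMinimal hn (FormalCR.quadric l + p) E) (N : ℕ) :
    ∃ h : FormalCR.AmbientSeries n, FormalCR.IsSpecialTransform h ∧
      (N : ℕ∞) ≤ (FormalCR.imPart (FormalCR.transformed h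
        (FormalCR.quadric l + p + MvPowerSeries.C Complex.I * E))).order := by
  open FormalCR in
  set ρ : Series n := quadric l + p + MvPowerSeries.C Complex.I * E with hρdef
  have hG : IsReal (quadric l + p) := by
    rw [IsReal, map_add, hp, ← coe_quadricPoly, conj_coe, pconj_quadricPoly]
  have hρ : IsLeading 2 ρ (quadricPoly l) := by
    refine ⟨isHomogeneous_quadricPoly l, ?_⟩
    rw [coe_quadricPoly, hρdef,
      show quadric l + p + MvPowerSeries.C Complex.I * E - quadric l =
        p + MvPowerSeries.C Complex.I * E by ring]
    exact le_order_add hp3 (hE3.trans (le_trans le_add_self MvPowerSeries.le_order_mul))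
  have h0 : dz (lastIdx hn) ρ ≠ 0 := by
    intro h0
    have h1 := hρ.dz (lastIdx hn)
    rw [h0, pdz_quadricPoly] at h1
    exact qz_ne_zero l _ (h1.unique (by
      simpa using IsLeading.coe (MvPolynomial.isHomogeneous_zero (Fin n ⊕ Fin n) ℂ 1)))
  have H := hM.transverse hG hE h0
  suffices h : ∀ m : ℕ, ∃ h : MvPolynomial (Fin n ⊕ Unit) ℂ,
      IsSpecialTransform (h : AmbientSeries n) ∧
        ((m + 3 : ℕ) : ℕ∞) ≤ (imPart (plugSeries ρ h)).order by
    obtain ⟨h, hh, ho⟩ := h N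
    refine ⟨h, hh, ?_⟩
    rw [transformed_coe]
    exact le_trans (Nat.cast_le.mpr (by omega)) ho
  intro m
  induction m with
  | zero =>
    refine ⟨MvPolynomial.X (Sum.inr ()), ⟨isConvergent_coe _, by simp⟩, ?_⟩
    have h1 : plugSeries ρ (MvPolynomial.X (Sum.inr ())) = ρ := by simp [plugSeries]
    have h2 : imPart ρ = E := by
      refine mul_left_cancel₀ C_two_I_ne_zero ?_
      rw [two_I_mul_imPart, hρdef, conj_add_I_mul hG hE, map_mul, map_ofNat]
      ring
    rw [h1, h2]
    exact hE3
  | succ m ih =>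
    obtain ⟨h, hh, ho⟩ := ih
    exact exists_special_succ hn hl hl' hρ H (by omega) hh ho
end
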